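/- **Setting.** Let $n$ be the number of workers and $0\le s<n$ the number of stragglers to be tolerated, and let $\mathbb F\in\{\mathbb R,\mathbb C\}$. A matrix $B\in\mathbb F^{n\times n}$ and a function $A$ that assigns to each $K\subseteq[n]$ a vector $A(K)\in\mathbb F^n$, with $\operatorname{supp}A(K)\subseteq K$ for $K\ne\emptyset$, satisfy the *exact computation (EC) condition* if $A(K)\cdot B=(1,\dots,1)$ for all $K\subseteq[n]$ with $|K|\ge n-s$. The *storage overhead* $d$ of $B$ is the largest number of nonzero entries in a row of $B$. Complexity is the number of arithmetic operations over $\mathbb C$: finitely many complex numbers are *computed from a set $I$ in $L$ operations* if there is a sequence $g_1,\dots,g_L$, each $g_k$ being a sum, difference, product or quotient of two elements of $I\cup\{g_1,\dots,g_{k-1}\}$, such that all these numbers lie in $I\cup\{g_1,\dots,g_L\}$. The set $I_0$ of free constants consists of the integers and all roots of unity. The complexity of encoding is the number of operations needed to compute the entries of $B$ from $I_0$; the complexity of decoding for a given $K$ is the number of operations needed to compute the entries of $A(K)$ from $I_0$ (the choice of the sequence may depend on $n,s,K$, at no cost). Let $g_s$ be the least number of operations that suffices, for every invertible generalized Vandermonde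 matrix $V=(x_i^{e_j})_{i,j=1}^s$ with $x_i\in\mathbb C$, $e_j\in\mathbb Z_{\ge0}$, to compute the entries of $V^{-1}$ from $I_0$ and the entries of $V$. Put $\omega=e^{2\pi i/n}$, index coordinates by $0,\dots,n-1$, and for $c\in\mathbb C^n$ let $B(c)$ be the matrix whose columns are $c$ and its cyclic shifts, $B(c)_{i,j}=c_{i-j \bmod n}$. **Theorem.** There is an absolute constant $C>0$ such that the following holds for all integers $0\le s<n$. 1. Let $B=B(c)$ with $c_i=\prod_{j=s+1}^{n-1}(\omega^i-\omega^j)$. There is a complex-valued $A$ such that $A,B$ satisfy the EC condition; every row of $B$ has exactly $s+1$ nonzero entries, so that $d=s+1$, and this is optimal: every complex pair that satisfies the EC condition has storage overhead at least $s+1$. Encoding takes at most $C\,s(n-s)$ operations, and for every $K$ with $|K|\ge n-s$ decoding takes at most $C\,(s\log^2 s+n\log n)$ operations (with $0\log^2 0=0$). 2. If $n\not\equiv s\pmod 2$, let $c$ be the coefficient vector (from the constant term upwards, padded with zeros) of the polynomial $\prod_{k=0}^{s-1}(x-\omega^{b+k})$, $b=\frac{n-s+1}{2}$. Then $B=B(c)$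 is real, and there is a real-valued $A$ such that $A,B$ satisfy the EC condition; every row of $B$ has exactly $s+1$ nonzero entries, so that $d=s+1$, and this is optimal among real pairs. Encoding takes at most $C\min\{s\log^2 s,\,n\log n\}$ operations, and for every $K$ with $|K|\ge n-s$ decoding takes at most $C\,(g_s+s(n-s))$ operations. -/

import Mathlib

namespace GradientCoding

open Finset

noncomputable section

/-! ### Arithmetic complexity over `ℂ` -/

/-- A computation sequence over `ℂ` from the inputs `I`: every entry is obtained by one arithmetic
operation from two numbers, each of which is an input or an earlier entry. -/
def IsComputation (I : Set ℂ) {L : ℕ} (g : Fin L → ℂ) : Prop :=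
  ∀ k : Fin L, ∃ x ∈ I ∪ g '' {j | j < k}, ∃ y ∈ I ∪ g '' {j | j < k},
    g k = x + y ∨ g k = x - y ∨ g k = x * y ∨ (y ≠ 0 ∧ g k = x / y)

/-- All numbers in `T` can be computed from the inputs `I` by one computation sequence with at
most `r` arithmetic operations. -/
def ComputableWithin (I T : Set ℂ) (r : ℝ) : Prop :=
  ∃ L : ℕ, (L : ℝ) ≤ r ∧ ∃ g : Fin L → ℂ, IsComputation I g ∧ T ⊆ I ∪ Set.range g

/-- The constants that an algorithm may use at no cost: the integers and the roots of unity. -/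
def freeConstants : Set ℂ :=
  {z | (∃ k : ℤ, z = k) ∨ ∃ m : ℕ, 0 < m ∧ z ^ m = 1}

/-- The set of entries of a matrix. -/
def entries {m n : ℕ} (M : Matrix (Fin m) (Fin n) ℂ) : Set ℂ :=
  {z | ∃ i j, z = M i j}

/-- The generalized Vandermonde matrix with nodes `x` and exponents `e`. -/
def generalizedVandermonde {s : ℕ} (x : Fin s → ℂ) (e : Fin s → ℕ) :
    Matrix (Fin s) (Fin s) ℂ :=
  Matrix.of fun i j => x i ^ e j

/-- `g_s`, the complexity of inverting an `s × s` generalized Vandermonde matrix: the least number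
of operations that suffices, for every invertible such matrix, to compute all entries of the
inverse from the entries of the matrix. -/
def vandermondeInversionCost (s : ℕ) : ℕ :=
  sInf {r : ℕ | ∀ (x : Fin s → ℂ) (e : Fin s → ℕ), (generalizedVandermonde x e).det ≠ 0 →
    ComputableWithin (freeConstants ∪ entries (generalizedVandermonde x e))
      (entries (generalizedVandermonde x e)⁻¹) r}

/-! ### Gradient coding schemes -/

/-- `A` and `B` satisfy the exact computation condition for `n` workers of which any `s` may be
stragglers: `A K` is supported on the set `K` of non-stragglers, and `A K * B` is the all-ones
vector whenever `K` has at least `n - s` elements. -/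
def ExactComputation {F : Type} [Field F] {n : ℕ} (s : ℕ) (A : Finset (Fin n) → Fin n → F)
    (B : Matrix (Fin n) (Fin n) F) : Prop :=
  (∀ K : Finset (Fin n), K.Nonempty → Function.support (A K) ⊆ (K : Set (Fin n))) ∧
    ∀ K : Finset (Fin n), n - s ≤ #K → Matrix.vecMul (A K) B = 1

/-- The storage overhead `d`: the largest number of data parts sent to a worker, that is, the
largest number of nonzero entries in a row of `B`. -/
def storageOverhead {F : Type} [Field F] {n : ℕ} (B : Matrix (Fin n) (Fin n) F) : ℕ :=
  Finset.univ.sup fun i => (Function.support (B i)).ncard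

/-- `A` and `B` satisfy the exact computation condition, every worker obtains exactly `s + 1` data
parts, and no pair that satisfies the condition has a smaller storage overhead. -/
def OptimalExactScheme {F : Type} [Field F] {n : ℕ} (s : ℕ) (A : Finset (Fin n) → Fin n → F)
    (B : Matrix (Fin n) (Fin n) F) : Prop :=
  ExactComputation s A B ∧
    (∀ i, (Function.support (B i)).ncard = s + 1) ∧ storageOverhead B = s + 1 ∧
    ∀ (A' : Finset (Fin n) → Fin n → F) (B' : Matrix (Fin n) (Fin n) F),
      ExactComputation s A' B' → s + 1 ≤ storageOverhead B'

/-! ### The explicit encoding matrices -/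

/-- The primitive root of unity `ω = exp (2πi / n)`. -/
def omega (n : ℕ) : ℂ :=
  Complex.exp (2 * Real.pi * Complex.I / n)

/-- The first column of the complex encoding matrix: the values of
`m(x) = ∏ (x - ω ^ j)`, where `s < j < n`, at the `n`-th roots of unity `ω ^ i`.
This is a codeword with support `{0, …, s}` of the Reed-Solomon code of the polynomials of degree
less than `n - s` on all `n`-th roots of unity. -/
def complexCodeword (n s : ℕ) (i : Fin n) : ℂ :=
  ∏ j ∈ Finset.Ioo s n, (omega n ^ (i : ℕ) - omega n ^ j)

/-- The generator polynomial of the real BCH code: its roots are the `s` consecutive powers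
`ω ^ b, …, ω ^ (b + s - 1)` with `b = (n - s + 1) / 2`. If `n` is even and `s` is odd they are the
powers with exponents from `n/2 - ⌊s/2⌋` to `n/2 + ⌊s/2⌋`; if `n` is odd and `s` is even, those
with exponents from `⌊n/2⌋ - s/2 + 1` to `⌊n/2⌋ + s/2`. -/
def bchGenerator (n s : ℕ) : Polynomial ℂ :=
  ∏ k ∈ Finset.range s, (Polynomial.X - Polynomial.C (omega n ^ ((n - s + 1) / 2 + k)))

/-- The matrix whose first column is `c` and whose columns are the cyclic shifts of `c`. -/
def cyclicShiftMatrix {n : ℕ} (c : Fin n → ℂ) : Matrix (Fin n) (Fin n) ℂ :=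
  Matrix.circulant c

end

end GradientCoding

/-! Both schemes are cyclic. Multiplying a decoding vector by a circulant matrix is a cyclic
correlation, so with vectors taken as values of polynomials at the `n`-th roots of unity everything
reduces to orthogonality of characters.

Complex scheme: the codeword lists the values of a polynomial `m` of degree `n - s - 1`. Decode with
the values of the locator `Λ` of the complement of `K`, whose degree is at most `s`. Column `j`
yields the sum of `Λ(ω^j x) m(x)` over all `n`-th roots of unity. The degree is below `n`, so the
sum is `n Λ(0) m(0)`, independent of `j`; dividing by it gives the all-ones vector
(`exactComputation_complex`). Since `Λ(0) m(0)` is a root of unity up to sign, it is free. The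
locator is expanded by divide and conquer and evaluated by a chirp transform.

Real scheme: the column consists of the coefficients of the generator `g`, and column `j` against
the values of `Y` gives `∑ Y_e ω^{je} g(ω^e)`. If `Y` has constant term 1 and all its other
exponents belong to roots of `g`, only `g(1)` survives (`sum_eval_mul_circulant_bch`). Such a `Y`
vanishing at the stragglers is `Λ h`, where `h` inverts `Λ` modulo `X^b`
(`exists_inverse_mod_X_pow`). Real parts then give a real decoder because `B` is real. A two-term
recurrence produces the coefficients of `g` in `O(s)` operations, and decoding takes `O(s(n-s))`.

Optimality is a double count of nonzero entries: every column needs at least `s + 1` of them.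

Costs are tracked by `Cost`, whose growing sets of known numbers compose more easily than indexed
sequences. -/

namespace GradientCoding

open Finset Polynomial

/-! ### A calculus of computation costs -/

/-- `Chain I L J`: the set `J` arises from `I` by adjoining the results of `L` successive
arithmetic operations. -/
inductive Chain (I : Set ℂ) : ℕ → Set ℂ → Prop
  | nil : Chain I 0 I
  | cons {L : ℕ} {J : Set ℂ} {x y z : ℂ} (h : Chain I L J) (hx : x ∈ J) (hy : y ∈ J)
      (hz : z = x + y ∨ z = x - y ∨ z = x * y ∨ (y ≠ 0 ∧ z = x / y)) :
      Chain I (L + 1) (insert z J)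

/-- All numbers in `T` can be computed from `I` with at most `L` operations. -/
def Cost (I T : Set ℂ) (L : ℕ) : Prop :=
  ∃ l ≤ L, ∃ J, Chain I l J ∧ T ⊆ J

theorem Chain.subset {I J : Set ℂ} {L : ℕ} (h : Chain I L J) : I ⊆ J := by
  induction h with
  | nil => exact subset_rfl
  | cons _ _ _ _ ih => exact ih.trans (Set.subset_insert _ _)

theorem Chain.trans {I J M : Set ℂ} {a b : ℕ} (h : Chain I a J) (h' : Chain J b M) :
    Chain I (a + b) M := by
  induction h' with
  | nil => exact h
  | cons _ hx hy hz ih => exact ih.cons hx hy hz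

/-- Extra known numbers can be carried along unused; this makes costs monotone in the inputs and
composable. -/
theorem Chain.union_left {I J : Set ℂ} {L : ℕ} (I' : Set ℂ) (h : Chain I L J) :
    Chain (I' ∪ I) L (I' ∪ J) := by
  induction h with
  | nil => exact Chain.nil
  | cons _ hx hy hz ih =>
    rw [Set.union_insert]
    exact ih.cons (Or.inr hx) (Or.inr hy) hz

theorem Chain.exists_computation {I J : Set ℂ} {L : ℕ} (h : Chain I L J) :
    ∃ g : Fin L → ℂ, IsComputation I g ∧ J = I ∪ Set.range g := by
  induction h with
  | nil => exact ⟨Fin.elim0, fun k => k.elim0, by simp⟩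
  | @cons L J x y z _ hx hy hz ih =>
    obtain ⟨g, hg, rfl⟩ := ih
    refine ⟨Fin.snoc g z, fun k => ?_, ?_⟩
    · refine Fin.lastCases ?_ (fun k => ?_) k
      · have key : ∀ w ∈ I ∪ Set.range g,
            w ∈ I ∪ (Fin.snoc g z : Fin (L + 1) → ℂ) '' {j | j < Fin.last L} := by
          rintro w (hw | ⟨j, rfl⟩)
          · exact Or.inl hw
          · exact Or.inr ⟨j.castSucc, Fin.castSucc_lt_last j, by simp⟩
        refine ⟨x, key x hx, y, key y hy, ?_⟩
        simpa using hz
      · obtain ⟨x, hx, y, hy, h⟩ := hg k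
        have key : ∀ w ∈ I ∪ g '' {j | j < k},
            w ∈ I ∪ (Fin.snoc g z : Fin (L + 1) → ℂ) '' {j | j < k.castSucc} := by
          rintro w (hw | ⟨j, hj, rfl⟩)
          · exact Or.inl hw
          · exact Or.inr ⟨j.castSucc, by simpa using hj, by simp⟩
        refine ⟨x, key x hx, y, key y hy, ?_⟩
        simpa using h
    · rw [Fin.range_snoc, Set.union_insert]

theorem Cost.computableWithin {I T : Set ℂ} {L : ℕ} {r : ℝ} (h : Cost I T L) (hr : (L : ℝ) ≤ r) :
    ComputableWithin I T r := by
  obtain ⟨l, hl, J, hJ, hT⟩ := h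
  obtain ⟨g, hg, rfl⟩ := hJ.exists_computation
  exact ⟨l, (Nat.cast_le.2 hl).trans hr, g, hg, hT⟩

theorem Cost.of_subset {I T : Set ℂ} (h : T ⊆ I) (L : ℕ) : Cost I T L :=
  ⟨0, Nat.zero_le _, I, Chain.nil, h⟩

theorem Cost.mono {I I' T T' : Set ℂ} {L L' : ℕ} (h : Cost I T L) (hI : I ⊆ I') (hT : T' ⊆ T)
    (hL : L ≤ L') : Cost I' T' L' := by
  obtain ⟨l, hl, J, hJ, hTJ⟩ := h
  refine ⟨l, hl.trans hL, I' ∪ J, ?_, (hT.trans hTJ).trans Set.subset_union_right⟩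
  have := hJ.union_left I'
  rwa [Set.union_eq_self_of_subset_right hI] at this

theorem Cost.trans {I T U : Set ℂ} {a b : ℕ} (h : Cost I T a) (h' : Cost (I ∪ T) U b) :
    Cost I (T ∪ U) (a + b) := by
  obtain ⟨l, hl, J, hJ, hT⟩ := h
  obtain ⟨l', hl', M, hM, hU⟩ := h'
  have h1 := hM.union_left J
  rw [Set.union_eq_self_of_subset_right (Set.union_subset hJ.subset hT)] at h1
  exact ⟨l + l', by omega, J ∪ M, hJ.trans h1, Set.union_subset_union hT hU⟩

/-- Sequential composition, keeping only the final results. -/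
theorem Cost.bind {I T U : Set ℂ} {a b : ℕ} (h : Cost I T a) (h' : Cost (I ∪ T) U b) :
    Cost I U (a + b) :=
  (h.trans h').mono subset_rfl Set.subset_union_right le_rfl

theorem Cost.union {I T U : Set ℂ} {a b : ℕ} (h : Cost I T a) (h' : Cost I U b) :
    Cost I (T ∪ U) (a + b) :=
  h.trans (h'.mono Set.subset_union_left subset_rfl le_rfl)

theorem Cost.op {I : Set ℂ} {x y z : ℂ} (hx : x ∈ I) (hy : y ∈ I)
    (hz : z = x + y ∨ z = x - y ∨ z = x * y ∨ (y ≠ 0 ∧ z = x / y)) : Cost I {z} 1 :=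
  ⟨1, le_rfl, insert z I, Chain.nil.cons hx hy hz, by simp⟩

/-- One operation applied to two computed numbers. -/
theorem Cost.op₂ {I : Set ℂ} {x y z : ℂ} {a b : ℕ} (hx : Cost I {x} a) (hy : Cost I {y} b)
    (hz : z = x + y ∨ z = x - y ∨ z = x * y ∨ (y ≠ 0 ∧ z = x / y)) : Cost I {z} (a + b + 1) :=
  (hx.union hy).bind (Cost.op (Or.inr (Or.inl rfl)) (Or.inr (Or.inr rfl)) hz)

theorem Cost.mem {I : Set ℂ} {x : ℂ} (hx : x ∈ I) : Cost I {x} 0 :=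
  Cost.of_subset (Set.singleton_subset_iff.2 hx) 0

theorem Cost.image {ι : Type*} {I : Set ℂ} (s : Finset ι) (f : ι → ℂ) {a : ℕ}
    (h : ∀ i ∈ s, Cost I {f i} a) : Cost I (f '' s) (#s * a) := by
  classical
  induction s using Finset.induction_on with
  | empty => exact Cost.of_subset (by simp) _
  | insert i s hi ih =>
    have h1 := (h i (mem_insert_self _ _)).union (ih fun j hj => h j (mem_insert_of_mem hj))
    refine h1.mono subset_rfl ?_ ?_
    · rw [coe_insert, Set.image_insert_eq]; rfl
    · rw [card_insert_of_notMem hi]; exact le_of_eq (by ring)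

theorem Cost.sum {ι : Type*} {I : Set ℂ} (h0 : 0 ∈ I) (s : Finset ι) (f : ι → ℂ) {a : ℕ}
    (h : ∀ i ∈ s, Cost I {f i} a) : Cost I {∑ i ∈ s, f i} (#s * (a + 1)) := by
  classical
  induction s using Finset.induction_on with
  | empty => simpa using Cost.mem h0
  | insert i s hi ih =>
    rw [sum_insert hi, card_insert_of_notMem hi]
    exact ((h i (mem_insert_self _ _)).op₂ (ih fun j hj => h j (mem_insert_of_mem hj))
      (Or.inl rfl)).mono subset_rfl subset_rfl (le_of_eq (by ring))

theorem Cost.prod {ι : Type*} {I : Set ℂ} (h1 : 1 ∈ I) (s : Finset ι) (f : ι → ℂ) {a : ℕ}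
    (h : ∀ i ∈ s, Cost I {f i} a) : Cost I {∏ i ∈ s, f i} (#s * (a + 1)) := by
  classical
  induction s using Finset.induction_on with
  | empty => simpa using Cost.mem h1
  | insert i s hi ih =>
    rw [prod_insert hi, card_insert_of_notMem hi]
    exact ((h i (mem_insert_self _ _)).op₂ (ih fun j hj => h j (mem_insert_of_mem hj))
      (Or.inr (Or.inr (Or.inl rfl)))).mono subset_rfl subset_rfl (le_of_eq (by ring))

/-- The first `m + 1` terms of a sequence in which every term is computed from its predecessor. -/
theorem Cost.sequence {I : Set ℂ} (q : ℕ → ℂ) {a b : ℕ} (m : ℕ) (h0 : Cost I {q 0} b)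
    (h : ∀ k < m, Cost (I ∪ {q k}) {q (k + 1)} a) :
    Cost I (q '' {k | k ≤ m}) (b + m * a) := by
  induction m with
  | zero => simpa using h0
  | succ m ih =>
    have h1 := ih fun k hk => h k (by omega)
    have h2 := h1.trans ((h m (by omega)).mono (I' := I ∪ q '' {k | k ≤ m})
      (Set.union_subset_union_right _ (by
        rintro _ rfl; exact ⟨m, le_refl m, rfl⟩)) subset_rfl le_rfl)
    refine h2.mono subset_rfl ?_ (le_of_eq (by ring))
    rintro _ ⟨k, hk, rfl⟩
    rcases Nat.lt_or_ge m k with hk' | hk'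
    · obtain rfl : k = m + 1 := le_antisymm hk hk'
      exact Or.inr rfl
    · exact Or.inl ⟨k, hk', rfl⟩

/-- Conjugation is a field automorphism, so it turns a computation into one of the same length. This
gives cheap access to real parts. -/
theorem Cost.conj {I T : Set ℂ} {L : ℕ} (h : Cost I T L) :
    Cost (starRingEnd ℂ '' I) (starRingEnd ℂ '' T) L := by
  obtain ⟨l, hl, J, hJ, hT⟩ := h
  refine ⟨l, hl, _, ?_, Set.image_mono hT⟩
  clear hT hl
  induction hJ with
  | nil => exact Chain.nil
  | cons _ hx hy hz ih =>
    rw [Set.image_insert_eq]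
    refine ih.cons (Set.mem_image_of_mem _ hx) (Set.mem_image_of_mem _ hy) ?_
    rcases hz with rfl | rfl | rfl | ⟨hy0, rfl⟩
    · simp
    · simp
    · simp
    · exact Or.inr (Or.inr (Or.inr ⟨by simpa using hy0, by simp⟩))

/-! ### Free constants -/

theorem intCast_mem_freeConstants (k : ℤ) : (k : ℂ) ∈ freeConstants := Or.inl ⟨k, rfl⟩

theorem natCast_mem_freeConstants (k : ℕ) : (k : ℂ) ∈ freeConstants := Or.inl ⟨k, by simp⟩

theorem zero_mem_freeConstants : (0 : ℂ) ∈ freeConstants := by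
  simpa using natCast_mem_freeConstants 0

theorem one_mem_freeConstants : (1 : ℂ) ∈ freeConstants := by
  simpa using natCast_mem_freeConstants 1

theorem mem_freeConstants_of_pow_eq_one {z : ℂ} {m : ℕ} (hm : 0 < m) (h : z ^ m = 1) :
    z ∈ freeConstants := Or.inr ⟨m, hm, h⟩

theorem conj_image_freeConstants : starRingEnd ℂ '' freeConstants ⊆ freeConstants := by
  rintro _ ⟨z, ⟨k, rfl⟩ | ⟨m, hm, h⟩, rfl⟩
  · simpa using intCast_mem_freeConstants k
  · exact Or.inr ⟨m, hm, by rw [← map_pow, h, map_one]⟩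

theorem Cost.conj_free {T : Set ℂ} {L : ℕ} (h : Cost freeConstants T L) :
    Cost freeConstants (starRingEnd ℂ '' T) L :=
  h.conj.mono conj_image_freeConstants subset_rfl le_rfl

theorem isPrimitiveRoot_omega {n : ℕ} (hn : n ≠ 0) : IsPrimitiveRoot (omega n) n :=
  Complex.isPrimitiveRoot_exp n hn

theorem omega_ne_zero (n : ℕ) : omega n ≠ 0 := Complex.exp_ne_zero _

theorem omega_pow_mem_freeConstants {n : ℕ} (hn : n ≠ 0) (k : ℕ) :
    omega n ^ k ∈ freeConstants :=
  mem_freeConstants_of_pow_eq_one (Nat.pos_of_ne_zero hn) (by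
    rw [← pow_mul, mul_comm, pow_mul, (isPrimitiveRoot_omega hn).pow_eq_one, one_pow])

/-! ### The discrete Fourier transform -/

/-- The inverse discrete Fourier transform of the values of a polynomial. -/
theorem sum_eval_mul_inv_pow {N : ℕ} {ζ : ℂ} (hζ : IsPrimitiveRoot ζ N) {f : ℂ[X]}
    (hf : f.natDegree < N) {m : ℕ} (hm : m < N) :
    ∑ i ∈ range N, f.eval (ζ ^ i) * (ζ⁻¹ ^ m) ^ i = N * f.coeff m := by
  have hN : N ≠ 0 := by omega
  have hζ0 : ζ ≠ 0 := hζ.ne_zero hN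
  have h1 : ∀ i, f.eval (ζ ^ i) * (ζ⁻¹ ^ m) ^ i
      = ∑ j ∈ range N, f.coeff j * (ζ ^ j * ζ⁻¹ ^ m) ^ i := by
    intro i
    rw [eval_eq_sum_range' hf, sum_mul]
    refine sum_congr rfl fun j _ => ?_
    rw [mul_pow, ← pow_mul, ← pow_mul, mul_comm i j]; ring
  simp_rw [h1]
  rw [sum_comm]
  simp_rw [← mul_sum]
  rw [sum_eq_single m]
  · rw [← mul_pow, mul_inv_cancel₀ hζ0]; simp [mul_comm]
  · intro j hj hjm
    have hj' := mem_range.1 hj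
    have hne : ζ ^ j * ζ⁻¹ ^ m ≠ 1 := by
      intro h
      rw [inv_pow, mul_inv_eq_one₀ (pow_ne_zero _ hζ0)] at h
      exact hjm (hζ.pow_inj hj' hm h)
    rw [geom_sum_eq hne, mul_pow, ← pow_mul, ← pow_mul, mul_comm j, mul_comm m, pow_mul, pow_mul,
      inv_pow, hζ.pow_eq_one]
    simp
  · intro h; exact absurd (mem_range.2 hm) h

theorem sum_range_two_mul {M : Type*} [AddCommMonoid M] (f : ℕ → M) (m : ℕ) :
    ∑ j ∈ range (2 * m), f j = ∑ j ∈ range m, f (2 * j) + ∑ j ∈ range m, f (2 * j + 1) := by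
  induction m with
  | zero => simp
  | succ m ih =>
    rw [show 2 * (m + 1) = 2 * m + 1 + 1 by ring, sum_range_succ, sum_range_succ, ih,
      sum_range_succ, sum_range_succ]
    abel

/-- The radix-two fast Fourier transform. -/
theorem cost_fft {I : Set ℂ} (hI : freeConstants ⊆ I) (k : ℕ) {ζ : ℂ} (hζ : ζ ^ 2 ^ k = 1)
    (a : ℕ → ℂ) (ha : ∀ j, a j ∈ I) :
    Cost I (Set.range fun i : ℕ => ∑ j ∈ range (2 ^ k), a j * (ζ ^ i) ^ j)
      (2 * k * 2 ^ k) := by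
  induction k generalizing ζ a with
  | zero =>
    refine Cost.of_subset ?_ _
    rintro _ ⟨i, rfl⟩
    simpa using ha 0
  | succ k ih =>
    have hζ2 : (ζ ^ 2) ^ 2 ^ k = 1 := by rw [← pow_mul, ← pow_succ', hζ]
    have h1 := (ih hζ2 (fun j => a (2 * j)) fun j => ha _).union
      (ih hζ2 (fun j => a (2 * j + 1)) fun j => ha _)
    -- Butterfly step: each value is the even part plus `ζ ^ i` times the odd part, hence two
    -- operations.
    have h2 := h1.bind (b := #(range (2 ^ (k + 1))) * 2) (Cost.image (range (2 ^ (k + 1)))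
      (fun i : ℕ => ∑ j ∈ range (2 ^ (k + 1)), a j * (ζ ^ i) ^ j) fun i _ => by
        have hz : ζ ^ i ∈ I := hI (mem_freeConstants_of_pow_eq_one (m := 2 ^ (k + 1))
          (by positivity) (by rw [← pow_mul, mul_comm, pow_mul, hζ, one_pow]))
        refine ((Cost.mem (Or.inr (Or.inl ⟨i, rfl⟩))).op₂ ((Cost.mem (Or.inl hz)).op₂
          (Cost.mem (Or.inr (Or.inr ⟨i, rfl⟩))) (Or.inr (Or.inr (Or.inl rfl)))) (Or.inl ?_))
        rw [pow_succ', sum_range_two_mul, mul_sum]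
        congr 1
        · refine sum_congr rfl fun j _ => ?_
          simp only [← pow_mul]; congr 2; ring
        · refine sum_congr rfl fun j _ => ?_
          simp only [← pow_mul]; rw [mul_left_comm, ← pow_add]; congr 2; ring)
    refine h2.mono subset_rfl ?_ (le_of_eq (by rw [card_range]; ring))
    rintro _ ⟨i, rfl⟩
    refine ⟨i % 2 ^ (k + 1), by
      simpa using Nat.mod_lt _ (by positivity : 0 < 2 ^ (k + 1)), ?_⟩
    simp only [← pow_eq_pow_mod i hζ]

/-- Fast multiplication of polynomials. -/
theorem cost_mul {I : Set ℂ} (hI : freeConstants ⊆ I) (k : ℕ) {p q : ℂ[X]}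
    (hp : Set.range p.coeff ⊆ I) (hq : Set.range q.coeff ⊆ I)
    (hpq : p.natDegree + q.natDegree < 2 ^ k) :
    Cost I (Set.range (p * q).coeff) ((6 * k + 2) * 2 ^ k) := by
  obtain ⟨ζ, hζ⟩ : ∃ ζ : ℂ, IsPrimitiveRoot ζ (2 ^ k) :=
    ⟨_, Complex.isPrimitiveRoot_exp (2 ^ k) (by positivity)⟩
  have hd : (p * q).natDegree < 2 ^ k := natDegree_mul_le.trans_lt hpq
  have ev : ∀ f : ℂ[X], Set.range f.coeff ⊆ I → f.natDegree < 2 ^ k →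
      Cost I (Set.range fun i : ℕ => f.eval (ζ ^ i)) (2 * k * 2 ^ k) := by
    intro f hf hfd
    have := cost_fft hI k hζ.pow_eq_one f.coeff fun j => hf ⟨j, rfl⟩
    simpa only [eval_eq_sum_range' hfd] using this
  have h1 := (ev p hp (by omega)).union (ev q hq (by omega))
  have h2 := h1.bind (Cost.image (a := 1) (range (2 ^ k)) (fun i : ℕ => (p * q).eval (ζ ^ i))
    fun i _ => Cost.op (Or.inr (Or.inl ⟨i, rfl⟩)) (Or.inr (Or.inr ⟨i, rfl⟩))
      (Or.inr (Or.inr (Or.inl eval_mul))))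
  have h2' : Cost I (Set.range fun i : ℕ => (p * q).eval (ζ ^ i))
      (2 * k * 2 ^ k + 2 * k * 2 ^ k + #(range (2 ^ k)) * 1) := by
    refine h2.mono subset_rfl ?_ le_rfl
    rintro _ ⟨i, rfl⟩
    refine ⟨i % 2 ^ k, by simpa using Nat.mod_lt _ (by positivity : 0 < 2 ^ k), ?_⟩
    simp only [← pow_eq_pow_mod i hζ.pow_eq_one]
  -- Interpolation is a transform with `ζ⁻¹`, followed by division by `2 ^ k`.
  have h3 := h2'.bind (cost_fft (I := I ∪ _) (hI.trans Set.subset_union_left) k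
    (ζ := ζ⁻¹) (by rw [inv_pow, hζ.pow_eq_one, inv_one]) (fun i : ℕ => (p * q).eval (ζ ^ i))
    fun i => Or.inr ⟨i, rfl⟩)
  have hN : ((2 ^ k : ℕ) : ℂ) ≠ 0 := Nat.cast_ne_zero.2 (by positivity)
  have h4 := h3.bind (Cost.image (a := 1) (range (2 ^ k)) (p * q).coeff
    fun m hm => Cost.op (y := ((2 ^ k : ℕ) : ℂ)) (Or.inr ⟨m, rfl⟩)
      (Or.inl (hI (natCast_mem_freeConstants _))) (Or.inr (Or.inr (Or.inr
        ⟨hN, by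
          beta_reduce
          rw [sum_eval_mul_inv_pow hζ hd (mem_range.1 hm), mul_div_cancel_left₀ _ hN]⟩))))
  have h5 := h4.union (Cost.of_subset (T := {0})
    (Set.singleton_subset_iff.2 (hI zero_mem_freeConstants)) 0)
  refine h5.mono subset_rfl ?_ (le_of_eq (by rw [card_range]; ring))
  rintro _ ⟨m, rfl⟩
  rcases Nat.lt_or_ge m (2 ^ k) with hm | hm
  · exact Or.inl ⟨m, by simpa using hm, rfl⟩
  · exact Or.inr (coeff_eq_zero_of_natDegree_lt (hd.trans_le hm))

/-- The coefficients of a product of linear factors, by divide and conquer. -/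
theorem cost_prod_X_sub_C {ι : Type*} {I : Set ℂ} (hI : freeConstants ⊆ I) (r : ι → ℂ)
    (hr : ∀ i, r i ∈ I) (k : ℕ) (S : Finset ι) (hS : #S ≤ 2 ^ k) :
    Cost I (Set.range (∏ i ∈ S, (X - C (r i))).coeff) ((6 * k ^ 2 + 22 * k + 1) * 2 ^ k) := by
  classical
  have hone : Set.range (1 : ℂ[X]).coeff ⊆ I := by
    rintro _ ⟨m, rfl⟩
    rw [coeff_one]
    split_ifs
    · exact hI one_mem_freeConstants
    · exact hI zero_mem_freeConstants
  induction k generalizing S with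
  | zero =>
    rcases S.eq_empty_or_nonempty with rfl | hne
    · exact Cost.of_subset (by simpa using hone) _
    · obtain ⟨i, rfl⟩ : ∃ i, S = {i} :=
        card_eq_one.1 (le_antisymm (by simpa using hS) hne.card_pos)
      have h : Cost I (I ∪ {0 - r i}) (0 + 1) := (Cost.of_subset subset_rfl 0).union
        (Cost.op (hI zero_mem_freeConstants) (hr i) (Or.inr (Or.inl rfl)))
      refine h.mono subset_rfl ?_ (by simp)
      rintro _ ⟨m, rfl⟩
      rw [prod_singleton]
      rcases m with _ | _ | m
      · exact Or.inr (by simp)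
      · exact Or.inl (by simpa using hI one_mem_freeConstants)
      · refine Or.inl ?_
        rw [coeff_eq_zero_of_natDegree_lt (by rw [natDegree_X_sub_C]; omega)]
        exact hI zero_mem_freeConstants
  | succ k ih =>
    obtain ⟨S₁, h₁, hc⟩ : ∃ S₁ ⊆ S, #S₁ = #S / 2 := exists_subset_card_eq (by omega)
    have hc₂ : #(S \ S₁) = #S - #S / 2 := by rw [card_sdiff_of_subset h₁, hc]
    rw [pow_succ] at hS
    have h1 := (ih S₁ (by omega)).union (ih (S \ S₁) (by omega))
    -- The product may have degree exactly `2 ^ (k + 1)`, so the transform length must be the next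
    -- power of two.
    have h2 := h1.bind (cost_mul (I := I ∪ _) (hI.trans Set.subset_union_left) (k + 2)
      (fun x hx => Or.inr (Or.inl hx)) (fun x hx => Or.inr (Or.inr hx)) (by
        rw [natDegree_prod_of_monic _ _ fun i _ => monic_X_sub_C _,
          natDegree_prod_of_monic _ _ fun i _ => monic_X_sub_C _]
        simp only [natDegree_X_sub_C, sum_const, smul_eq_mul, mul_one]
        have : 0 < 2 ^ k := by positivity
        rw [pow_add]
        omega))
    rw [mul_comm, prod_sdiff h₁] at h2
    exact h2.mono subset_rfl subset_rfl (le_of_eq (by ring))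

/-- Evaluation at all `n`-th roots of unity for arbitrary `n`, by means of a convolution with
a chirp. -/
theorem cost_eval_omega {I : Set ℂ} (hI : freeConstants ⊆ I) {n k : ℕ} (hk : 3 * n ≤ 2 ^ k)
    {p : ℂ[X]} (hp : Set.range p.coeff ⊆ I) (hd : p.natDegree < n) :
    Cost I (Set.range fun i : Fin n => p.eval (omega n ^ (i : ℕ)))
      ((6 * k + 2) * 2 ^ k + 2 * n) := by
  classical
  have hn : n ≠ 0 := by omega
  -- A square root of `ω`: from `2ij = (i+j)² - i² - j²` one gets `ω^{ij} = η^{(i+j)²} / (η^{i²}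
  -- η^{j²})`. Reversing the coefficients in `a` turns the resulting correlation into a polynomial
  -- product.
  set η := omega (2 * n) with hη
  have hη0 : η ≠ 0 := omega_ne_zero _
  have hη2 : η ^ 2 = omega n := by
    rw [hη, omega, omega, ← Complex.exp_nat_mul]
    congr 1
    push_cast
    field_simp
  have hηm : ∀ j, η ^ j ∈ I := fun j => hI (omega_pow_mem_freeConstants (by omega) j)
  set a : ℂ[X] := ∑ j ∈ range n, C (p.coeff j / η ^ j ^ 2) * X ^ (n - 1 - j) with ha
  set b : ℂ[X] := ∑ j ∈ range (2 * n), C (η ^ j ^ 2) * X ^ j with hb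
  have hac : ∀ m, a.coeff m =
      if m < n then p.coeff (n - 1 - m) / η ^ (n - 1 - m) ^ 2 else 0 := by
    intro m
    simp only [ha, finsetSum_coeff, coeff_C_mul_X_pow]
    split_ifs with hm
    · rw [sum_eq_single (n - 1 - m)]
      · rw [if_pos (by omega)]
      · intro j hj hjm
        have := mem_range.1 hj
        exact if_neg (by omega)
      · intro h; exact absurd (mem_range.2 (by omega)) h
    · exact sum_eq_zero fun j hj => if_neg (by omega)
  have hbc : ∀ m, b.coeff m = if m < 2 * n then η ^ m ^ 2 else 0 := by
    intro m
    simp only [hb, finsetSum_coeff, coeff_C_mul_X_pow, sum_ite_eq, mem_range]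
  have had : a.natDegree < n := by
    have : a.natDegree ≤ n - 1 := natDegree_le_iff_coeff_eq_zero.2 fun m hm => by
      rw [hac, if_neg (by omega)]
    omega
  have hbd : b.natDegree < 2 * n := by
    have : b.natDegree ≤ 2 * n - 1 := natDegree_le_iff_coeff_eq_zero.2 fun m hm => by
      rw [hbc, if_neg (by omega)]
    omega
  have h1 : Cost I (Set.range a.coeff) (n * 1) := by
    have h := (Cost.image (I := I) (a := 1) (range n) a.coeff fun m hm => by
      rw [hac, if_pos (mem_range.1 hm)]
      exact Cost.op (hp ⟨_, rfl⟩) (hηm _)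
        (Or.inr (Or.inr (Or.inr ⟨pow_ne_zero _ hη0, rfl⟩)))).union
      (Cost.mem (hI zero_mem_freeConstants))
    refine h.mono subset_rfl ?_ (by simp)
    rintro _ ⟨m, rfl⟩
    rcases Nat.lt_or_ge m n with hm | hm
    · exact Or.inl ⟨m, by simpa using hm, rfl⟩
    · exact Or.inr (by rw [hac, if_neg (by omega)]; rfl)
  have h2 := h1.bind (cost_mul (I := I ∪ _) (q := b) (hI.trans Set.subset_union_left) k
    (fun x hx => Or.inr hx) (by
      rintro _ ⟨m, rfl⟩
      rw [hbc]
      split_ifs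
      · exact Or.inl (hηm _)
      · exact Or.inl (hI zero_mem_freeConstants)) (by omega))
  have hab : ∀ i < n, (a * b).coeff (n - 1 + i) =
      ∑ j ∈ range n, p.coeff j / η ^ j ^ 2 * η ^ (i + j) ^ 2 := by
    intro i hi
    rw [ha, sum_mul, finsetSum_coeff]
    refine sum_congr rfl fun j hj => ?_
    have hj' := mem_range.1 hj
    rw [mul_assoc, coeff_C_mul, show n - 1 + i = (i + j) + (n - 1 - j) by omega,
      coeff_X_pow_mul, hbc, if_pos (by omega)]
  have h3 := h2.bind (Cost.image (a := 1) (univ : Finset (Fin n))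
    (fun i : Fin n => p.eval (omega n ^ (i : ℕ))) fun i _ =>
      Cost.op (Or.inr ⟨n - 1 + i, rfl⟩) (Or.inl (hηm ((i : ℕ) ^ 2)))
        (Or.inr (Or.inr (Or.inr ⟨pow_ne_zero _ hη0, by
          rw [hab i i.2, sum_div, eval_eq_sum_range' hd]
          refine sum_congr rfl fun j _ => ?_
          rw [← hη2, show ((i : ℕ) + j) ^ 2 = j ^ 2 + i ^ 2 + 2 * (i * j) by ring, pow_add, pow_add,
            ← pow_mul, ← pow_mul]
          field_simp⟩))))
  refine h3.mono subset_rfl ?_ (le_of_eq (by rw [card_univ, Fintype.card_fin]; ring))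
  rw [coe_univ, Set.image_univ]

/-! ### Optimality of the storage overhead -/

/-- Otherwise the workers not holding part `j` number at least `n - s`, yet no combination of their
rows has a 1 in coordinate `j`. -/
theorem ExactComputation.succ_le_card_column {F : Type} [Field F] {n s : ℕ} (hs : s < n)
    {A : Finset (Fin n) → Fin n → F} {B : Matrix (Fin n) (Fin n) F}
    (h : ExactComputation s A B) (j : Fin n) [DecidableEq F] :
    s + 1 ≤ #{i | B i j ≠ 0} := by
  by_contra! hlt
  set K : Finset (Fin n) := {i | B i j = 0} with hK
  have hcard : #{i | B i j ≠ 0} + #K = n := by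
    have := card_filter_add_card_filter_not (s := (univ : Finset (Fin n))) (fun i => B i j ≠ 0)
    simpa [hK] using this
  have hKc : n - s ≤ #K := by omega
  have h1 := congrFun (h.2 K hKc) j
  rw [Matrix.vecMul, dotProduct, sum_eq_zero] at h1
  · simp at h1
  · intro i _
    by_cases hi : B i j = 0
    · rw [hi, mul_zero]
    · have : A K i = 0 := by
        by_contra hA
        have := h.1 K (card_pos.1 (by omega)) hA
        exact hi (by simpa [hK] using this)
      rw [this, zero_mul]

theorem ExactComputation.succ_le_storageOverhead {F : Type} [Field F] {n s : ℕ} (hs : s < n)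
    {A : Finset (Fin n) → Fin n → F} {B : Matrix (Fin n) (Fin n) F}
    (h : ExactComputation s A B) : s + 1 ≤ storageOverhead B := by
  classical
  have hrow : ∀ i, #{j | B i j ≠ 0} ≤ storageOverhead B := by
    intro i
    have h1 : (Function.support (B i)).ncard = #{j | B i j ≠ 0} := by
      rw [← Set.ncard_coe_finset]
      congr 1
      ext; simp
    rw [← h1]
    exact le_sup (f := fun i => (Function.support (B i)).ncard) (mem_univ i)
  have h1 : ∑ j : Fin n, #{i | B i j ≠ 0} = ∑ i : Fin n, #{j | B i j ≠ 0} := by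
    simp only [card_filter]
    exact sum_comm
  have h2 : n * (s + 1) ≤ n * storageOverhead B := by
    calc n * (s + 1) = ∑ _j : Fin n, (s + 1) := by simp
      _ ≤ ∑ j : Fin n, #{i | B i j ≠ 0} := sum_le_sum fun j _ => h.succ_le_card_column hs j
      _ = ∑ i : Fin n, #{j | B i j ≠ 0} := h1
      _ ≤ ∑ _i : Fin n, storageOverhead B := sum_le_sum fun i _ => hrow i
      _ = n * storageOverhead B := by simp
  exact Nat.le_of_mul_le_mul_left h2 (by omega)

/-! ### Circulant matrices -/

theorem ncard_support_circulant_row {F : Type} [Field F] {n s : ℕ} (hs : s < n) (c : Fin n → F)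
    (hc : ∀ i : Fin n, c i ≠ 0 ↔ (i : ℕ) ≤ s) (i : Fin n) :
    (Function.support (Matrix.circulant c i)).ncard = s + 1 := by
  have : NeZero n := ⟨by omega⟩
  have h1 : Function.support (Matrix.circulant c i) =
      (Equiv.subLeft i) ⁻¹' {k : Fin n | (k : ℕ) ≤ s} := by
    ext j
    simp [Matrix.circulant_apply, hc]
  rw [h1, ← Equiv.image_symm_eq_preimage, Set.ncard_image_of_injective _ (Equiv.injective _)]
  have h2 : {k : Fin n | (k : ℕ) ≤ s} = ((Finset.Iic (⟨s, hs⟩ : Fin n) : Finset (Fin n)) : Set _) := by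
    ext k; simp [Fin.le_def]
  rw [h2, Set.ncard_coe_finset, Fin.card_Iic]

/-- A circulant matrix generated by a vector with support `{0, …, s}` has optimal storage
overhead, once it admits a decoder. -/
theorem optimalExactScheme_circulant {F : Type} [Field F] {n s : ℕ} (hs : s < n) (c : Fin n → F)
    (hc : ∀ i : Fin n, c i ≠ 0 ↔ (i : ℕ) ≤ s) {A : Finset (Fin n) → Fin n → F}
    (hA : ExactComputation s A (Matrix.circulant c)) :
    OptimalExactScheme s A (Matrix.circulant c) := by
  refine ⟨hA, ncard_support_circulant_row hs c hc, ?_,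
    fun A' B' h => h.succ_le_storageOverhead hs⟩
  refine le_antisymm ?_ (hA.succ_le_storageOverhead hs)
  exact Finset.sup_le fun i _ => (ncard_support_circulant_row hs c hc i).le

theorem omega_pow_fin_add {n : ℕ} (i j : Fin n) :
    omega n ^ ((i + j : Fin n) : ℕ) = omega n ^ (i : ℕ) * omega n ^ (j : ℕ) := by
  have hn : n ≠ 0 := by have := i.2; omega
  rw [Fin.val_add, ← pow_eq_pow_mod _ (isPrimitiveRoot_omega hn).pow_eq_one, pow_add]

/-- Moves the shift from the codeword to the decoder, where it becomes multiplication of the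
argument by `ω^j`. -/
theorem sum_mul_circulant {n : ℕ} (y c : Fin n → ℂ) (j : Fin n) :
    ∑ i, y i * Matrix.circulant c i j = ∑ i, y (i + j) * c i := by
  have : NeZero n := ⟨by have := j.2; omega⟩
  rw [← Equiv.sum_comp (Equiv.addRight j)]
  simp [Matrix.circulant_apply]

/-! ### The complex scheme -/

/-- The polynomial whose values are the entries of `complexCodeword`. -/
noncomputable def codewordPoly (n s : ℕ) : ℂ[X] :=
  ∏ j ∈ Finset.Ioo s n, (X - C (omega n ^ j))

theorem eval_codewordPoly (n s : ℕ) (x : ℂ) :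
    (codewordPoly n s).eval x = ∏ j ∈ Finset.Ioo s n, (x - omega n ^ j) := by
  simp [codewordPoly, eval_prod]

theorem natDegree_codewordPoly (n s : ℕ) : (codewordPoly n s).natDegree = n - s - 1 := by
  rw [codewordPoly, natDegree_prod_of_monic _ _ fun i _ => monic_X_sub_C _]
  simp only [natDegree_X_sub_C, sum_const, smul_eq_mul, mul_one, Nat.card_Ioo]

/-- The locator polynomial of a set of positions. -/
noncomputable def locator {n : ℕ} (S : Finset (Fin n)) : ℂ[X] :=
  ∏ k ∈ S, (X - C (omega n ^ (k : ℕ)))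

theorem natDegree_locator {n : ℕ} (S : Finset (Fin n)) : (locator S).natDegree = #S := by
  rw [locator, natDegree_prod_of_monic _ _ fun i _ => monic_X_sub_C _]
  simp only [natDegree_X_sub_C, sum_const, smul_eq_mul, mul_one]

theorem eval_locator_eq_zero {n : ℕ} {S : Finset (Fin n)} {i : Fin n} (hi : i ∈ S) :
    (locator S).eval (omega n ^ (i : ℕ)) = 0 := by
  rw [locator, eval_prod]
  exact prod_eq_zero hi (by simp)

/-- The exponent `2n` rather than `n` absorbs the sign. Constant terms of locators and generators
are therefore free constants. -/
theorem prod_neg_omega_pow {ι : Type*} {n : ℕ} (hn : n ≠ 0) (S : Finset ι) (e : ι → ℕ) :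
    (∏ k ∈ S, (0 - omega n ^ e k)) ^ (2 * n) = 1 := by
  rw [← prod_pow]
  refine prod_eq_one fun k _ => ?_
  rw [zero_sub, Even.neg_pow (even_two_mul n), ← pow_mul, mul_comm, pow_mul, pow_mul',
    (isPrimitiveRoot_omega hn).pow_eq_one, one_pow, one_pow]

/-- The normalizing constant of the complex decoder. -/
noncomputable def normalizer (n s : ℕ) (K : Finset (Fin n)) : ℂ :=
  (locator Kᶜ).eval 0 * (codewordPoly n s).eval 0

theorem normalizer_pow {n : ℕ} (hn : n ≠ 0) (s : ℕ) (K : Finset (Fin n)) :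
    normalizer n s K ^ (2 * n) = 1 := by
  rw [normalizer, mul_pow, eval_codewordPoly, prod_neg_omega_pow hn, locator, eval_prod]
  simpa using prod_neg_omega_pow hn Kᶜ (fun k : Fin n => (k : ℕ))

theorem normalizer_ne_zero {n : ℕ} (hn : n ≠ 0) (s : ℕ) (K : Finset (Fin n)) :
    normalizer n s K ≠ 0 := by
  intro h
  have := normalizer_pow hn s K
  rw [h, zero_pow (by omega)] at this
  exact zero_ne_one this

/-- The decoder of the complex scheme. -/
noncomputable def complexDecoder (n s : ℕ) (K : Finset (Fin n)) (i : Fin n) : ℂ :=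
  (locator Kᶜ).eval (omega n ^ (i : ℕ)) / (n * normalizer n s K)

theorem exactComputation_complex {n s : ℕ} (hs : s < n) :
    ExactComputation s (complexDecoder n s) (cyclicShiftMatrix (complexCodeword n s)) := by
  have hn : n ≠ 0 := by omega
  refine ⟨fun K _ i hi => ?_, fun K hK => ?_⟩
  · by_contra h
    refine hi ?_
    rw [complexDecoder, eval_locator_eq_zero (by simpa using h), zero_div]
  · ext j
    rw [cyclicShiftMatrix, Matrix.vecMul, dotProduct, sum_mul_circulant, Pi.one_apply]
    set f : ℂ[X] := (locator Kᶜ).comp (X * C (omega n ^ (j : ℕ))) * codewordPoly n s with hf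
    -- At most `s` from the locator plus `n - s - 1` from the codeword.
    have hdeg : f.natDegree < n := by
      refine natDegree_mul_le.trans_lt ?_
      have h1 : ((locator Kᶜ).comp (X * C (omega n ^ (j : ℕ)))).natDegree ≤ #Kᶜ := by
        refine natDegree_comp_le.trans ?_
        rw [natDegree_locator]
        exact (Nat.mul_le_mul_left _ (natDegree_mul_C_le _ _)).trans (by simp)
      rw [natDegree_codewordPoly]
      rw [card_compl, Fintype.card_fin] at h1
      have h2 := card_le_univ K
      rw [Fintype.card_fin] at h2
      omega
    have h := sum_eval_mul_inv_pow (isPrimitiveRoot_omega hn) hdeg (m := 0) (by omega)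
    simp only [pow_zero, one_pow, mul_one] at h
    have h0 : f.coeff 0 = normalizer n s K := by
      rw [coeff_zero_eq_eval_zero, hf, eval_mul, eval_comp, normalizer]; simp
    rw [h0, ← Fin.sum_univ_eq_sum_range (fun i => f.eval (omega n ^ i))] at h
    have hne : (n : ℂ) * normalizer n s K ≠ 0 :=
      mul_ne_zero (Nat.cast_ne_zero.2 hn) (normalizer_ne_zero hn s K)
    refine Eq.trans ?_ ((congrArg (· / ((n : ℂ) * normalizer n s K)) h).trans (div_self hne))
    rw [sum_div]
    refine sum_congr rfl fun i _ => ?_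
    rw [complexDecoder, hf, eval_mul, eval_comp, eval_codewordPoly, omega_pow_fin_add,
      complexCodeword]
    simp only [eval_mul, eval_X, eval_C]
    ring

theorem complexCodeword_ne_zero_iff {n s : ℕ} (i : Fin n) :
    complexCodeword n s i ≠ 0 ↔ (i : ℕ) ≤ s := by
  have hn : n ≠ 0 := by have := i.2; omega
  rw [complexCodeword, prod_ne_zero_iff]
  constructor
  · intro h
    by_contra! hi
    exact h i (mem_Ioo.2 ⟨hi, i.2⟩) (sub_self _)
  · intro hi j hj h
    rw [mem_Ioo] at hj
    have := (isPrimitiveRoot_omega hn).pow_inj i.2 hj.2 (sub_eq_zero.1 h)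
    omega

/-! ### Operation counts for the complex scheme -/

theorem cost_complexEncoder {n s : ℕ} (hs : s < n) :
    Cost freeConstants (entries (cyclicShiftMatrix (complexCodeword n s)))
      (4 * (s * (n - s))) := by
  have hn : n ≠ 0 := by omega
  -- For `s = 0` the bound is zero; the only nonzero entry is `∏ (1 - ω^j) = n`, a free integer.
  rcases Nat.eq_zero_or_pos s with rfl | hs0
  · refine Cost.of_subset ?_ _
    rintro _ ⟨i, j, rfl⟩
    rw [cyclicShiftMatrix, Matrix.circulant_apply]
    by_cases h : ((i - j : Fin n) : ℕ) ≤ 0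
    · rw [complexCodeword, Nat.le_zero.1 h]
      obtain ⟨m, rfl⟩ : ∃ m, n = m + 1 := ⟨n - 1, by omega⟩
      have h1 := (isPrimitiveRoot_omega hn).prod_one_sub_pow_eq_order
      have h2 : ∏ j ∈ Ioo 0 (m + 1), (omega (m + 1) ^ 0 - omega (m + 1) ^ j) = ((m + 1 : ℕ) : ℂ) := by
        have h3 : Ioo 0 (m + 1) = Ico 1 (m + 1) := by ext; simp [Nat.one_le_iff_ne_zero,
          Nat.pos_iff_ne_zero]
        rw [Nat.cast_succ, ← h1, h3, prod_Ico_eq_prod_range]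
        simp [add_comm]
      rw [h2]
      exact natCast_mem_freeConstants _
    · rw [← complexCodeword_ne_zero_iff, not_not] at h
      rw [h]
      exact zero_mem_freeConstants
  · have h1 := (Cost.image (I := freeConstants) (a := (n - s - 1) * 2)
      ({i : Fin n | (i : ℕ) ≤ s} : Finset (Fin n)) (complexCodeword n s) fun i _ => by
        have := Cost.prod one_mem_freeConstants (Ioo s n)
          (fun j => omega n ^ (i : ℕ) - omega n ^ j) (a := 1) fun j _ =>
            Cost.op (omega_pow_mem_freeConstants hn _) (omega_pow_mem_freeConstants hn _)
              (Or.inr (Or.inl rfl))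
        rw [Nat.card_Ioo] at this
        exact this).union (Cost.mem zero_mem_freeConstants)
    refine h1.mono subset_rfl ?_ ?_
    · rintro _ ⟨i, j, rfl⟩
      rw [cyclicShiftMatrix, Matrix.circulant_apply]
      by_cases h : ((i - j : Fin n) : ℕ) ≤ s
      · exact Or.inl ⟨_, by simpa using h, rfl⟩
      · rw [← complexCodeword_ne_zero_iff, not_not] at h
        exact Or.inr h
    · have h2 : #({i : Fin n | (i : ℕ) ≤ s} : Finset (Fin n)) = s + 1 := by
        rw [← Fin.card_Iic (⟨s, hs⟩ : Fin n)]
        congr 1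
        ext k; simp [Fin.le_def]
      rw [h2]
      calc (s + 1) * ((n - s - 1) * 2) + 0 ≤ (2 * s) * ((n - s) * 2) :=
            Nat.mul_le_mul (by omega) (by omega)
        _ = _ := by ring

theorem cost_complexDecoder {n s k l : ℕ} (hs : s < n) {K : Finset (Fin n)}
    (hK : n - s ≤ #K) (hk : s ≤ 2 ^ k) (hl : 3 * n ≤ 2 ^ l) :
    Cost freeConstants (Set.range (complexDecoder n s K))
      ((6 * k ^ 2 + 22 * k + 1) * 2 ^ k + (6 * l + 2) * 2 ^ l + 3 * n + 1) := by
  have hn : n ≠ 0 := by omega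
  have hc : #Kᶜ ≤ s := by rw [card_compl, Fintype.card_fin]; omega
  have h1 := cost_prod_X_sub_C subset_rfl (fun k : Fin n => omega n ^ (k : ℕ))
    (fun k => omega_pow_mem_freeConstants hn _) k Kᶜ (hc.trans hk)
  have h2 := h1.bind (cost_eval_omega (I := freeConstants ∪ _) (p := locator Kᶜ)
    Set.subset_union_left hl (fun x hx => Or.inr hx) (by rw [natDegree_locator]; omega))
  have h3 := h2.union (Cost.op (z := n * normalizer n s K) (natCast_mem_freeConstants n)
    (mem_freeConstants_of_pow_eq_one (by omega) (normalizer_pow hn s K))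
    (Or.inr (Or.inr (Or.inl rfl))))
  have h4 := h3.bind (Cost.image (a := 1) univ (complexDecoder n s K) fun i _ =>
    Cost.op (Or.inr (Or.inl ⟨i, rfl⟩)) (Or.inr (Or.inr rfl)) (Or.inr (Or.inr (Or.inr
      ⟨mul_ne_zero (Nat.cast_ne_zero.2 hn) (normalizer_ne_zero hn s K), rfl⟩))))
  refine h4.mono subset_rfl ?_ (le_of_eq (by rw [card_univ, Fintype.card_fin]; ring))
  rw [coe_univ, Set.image_univ]

/-- The smallest scheme decodes with a free constant. -/
theorem complexDecoder_one {K : Finset (Fin 1)} (hK : 1 ≤ #K) :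
    Set.range (complexDecoder 1 0 K) ⊆ freeConstants := by
  have hKu : K = univ := (card_eq_iff_eq_univ K).1 (le_antisymm (card_le_univ K) (by simpa using hK))
  rintro _ ⟨i, rfl⟩
  have : complexDecoder 1 0 K i = 1 := by
    have hI : Ioo 0 1 = (∅ : Finset ℕ) := rfl
    rw [complexDecoder, normalizer, hKu, compl_univ, locator, codewordPoly, hI]
    simp
  rw [this]
  exact one_mem_freeConstants

theorem exists_complexDecoder_bound : ∃ C : ℝ, 0 < C ∧ ∀ n s : ℕ, s < n → ∀ K : Finset (Fin n),
    n - s ≤ #K → ComputableWithin freeConstants (Set.range (complexDecoder n s K))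
      (C * ((s : ℝ) * Real.log s ^ 2 + (n : ℝ) * Real.log n)) := by
  refine ⟨2000, by norm_num, fun n s hs K hK => ?_⟩
  have hlog2 : (0.69 : ℝ) < Real.log 2 := lt_trans (by norm_num) Real.log_two_gt_d9
  have hln : 0 ≤ Real.log n := Real.log_natCast_nonneg n
  -- For `n = 1` the bound is zero; from `n = 2` on, `log n` is bounded below and absorbs the linear
  -- terms.
  obtain rfl | hn2 : n = 1 ∨ 2 ≤ n := by omega
  · obtain rfl : s = 0 := by omega
    exact (Cost.of_subset (complexDecoder_one hK) 0).computableWithin (by simp)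
  have hn : n ≠ 0 := by omega
  set k := Nat.log 2 s with hk
  set l := Nat.log 2 n with hl
  have hk1 : s < 2 ^ (k + 1) := Nat.lt_pow_succ_log_self one_lt_two s
  have hl1 : n < 2 ^ (l + 1) := Nat.lt_pow_succ_log_self one_lt_two n
  have hl2 : 2 ^ l ≤ n := Nat.pow_log_le_self 2 hn
  have hkl : 2 ^ k ≤ n := by
    rcases Nat.eq_zero_or_pos s with rfl | h
    · simp [hk]; omega
    · exact (Nat.pow_log_le_self 2 (by omega)).trans hs.le
  have hks : 2 ^ k * k ^ 2 ≤ s * k ^ 2 := by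
    rcases Nat.eq_zero_or_pos s with rfl | h
    · simp [hk]
    · exact Nat.mul_le_mul_right _ (Nat.pow_log_le_self 2 (by omega))
  have hkk : k ≤ k ^ 2 := by nlinarith
  refine (cost_complexDecoder hs hK hk1.le (l := l + 3) (by
    rw [pow_add] at hl1 ⊢; omega)).computableWithin ?_
  have hnat : (6 * (k + 1) ^ 2 + 22 * (k + 1) + 1) * 2 ^ (k + 1) +
      (6 * (l + 3) + 2) * 2 ^ (l + 3) + 3 * n + 1 ≤
      80 * (s * k ^ 2) + 48 * (n * l) + 230 * n := by
    have e1 : (6 * (k + 1) ^ 2 + 22 * (k + 1) + 1) * 2 ^ (k + 1) ≤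
        80 * (2 ^ k * k ^ 2) + 58 * 2 ^ k := by
      have : (6 * (k + 1) ^ 2 + 22 * (k + 1) + 1) * 2 ≤ 80 * k ^ 2 + 58 := by nlinarith
      calc _ = ((6 * (k + 1) ^ 2 + 22 * (k + 1) + 1) * 2) * 2 ^ k := by ring
        _ ≤ (80 * k ^ 2 + 58) * 2 ^ k := Nat.mul_le_mul_right _ this
        _ = _ := by ring
    have e2 : (6 * (l + 3) + 2) * 2 ^ (l + 3) ≤ 48 * (n * l) + 160 * n := by
      calc _ = (48 * l + 160) * 2 ^ l := by ring
        _ ≤ (48 * l + 160) * n := Nat.mul_le_mul_left _ hl2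
        _ = _ := by ring
    omega
  have hreal : (((6 * (k + 1) ^ 2 + 22 * (k + 1) + 1) * 2 ^ (k + 1) +
      (6 * (l + 3) + 2) * 2 ^ (l + 3) + 3 * n + 1 : ℕ) : ℝ) ≤
      80 * (s * (k : ℝ) ^ 2) + 48 * (n * l) + 230 * n := by exact_mod_cast hnat
  refine hreal.trans ?_
  have hkr : (k : ℝ) * 0.69 ≤ Real.log s := by
    rcases Nat.eq_zero_or_pos s with rfl | h
    · simp [hk]
    · have h1 : ((2 : ℝ) ^ k) ≤ s := by exact_mod_cast Nat.pow_log_le_self 2 (by omega : s ≠ 0)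
      have h2 := Real.log_le_log (by positivity) h1
      rw [Real.log_pow] at h2
      nlinarith [(Nat.cast_nonneg k : (0 : ℝ) ≤ k)]
  have hlr : (l : ℝ) * 0.69 ≤ Real.log n := by
    have h1 : ((2 : ℝ) ^ l) ≤ n := by exact_mod_cast hl2
    have h2 := Real.log_le_log (by positivity) h1
    rw [Real.log_pow] at h2
    nlinarith [(Nat.cast_nonneg l : (0 : ℝ) ≤ l)]
  have hl0 : (0.69 : ℝ) ≤ Real.log n :=
    hlog2.le.trans (Real.log_le_log (by norm_num) (by exact_mod_cast hn2))
  have hn0 : (0 : ℝ) ≤ n := Nat.cast_nonneg n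
  have hs0 : (0 : ℝ) ≤ s := Nat.cast_nonneg s
  have hk0 : (0 : ℝ) ≤ k := Nat.cast_nonneg k
  have t1 : (s : ℝ) * (k : ℝ) ^ 2 ≤ 3 * (s * Real.log s ^ 2) := by
    have : (k : ℝ) ^ 2 ≤ 3 * Real.log s ^ 2 := by nlinarith
    nlinarith [mul_le_mul_of_nonneg_left this hs0]
  have t2 : (n : ℝ) * l ≤ 2 * (n * Real.log n) := by
    nlinarith [mul_le_mul_of_nonneg_left hlr hn0]
  have t3 : (n : ℝ) ≤ 2 * (n * Real.log n) := by
    nlinarith [mul_le_mul_of_nonneg_left hl0 hn0]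
  have t4 : 0 ≤ (s : ℝ) * Real.log s ^ 2 := by positivity
  nlinarith

/-! ### The real scheme: the generator polynomial -/

/-- The coefficients of `∏ (X - a q ^ k)` satisfy a two-term recurrence. -/
theorem coeff_prod_X_sub_C_geometric (a q : ℂ) (s j : ℕ) :
    a * q ^ s * (1 - q ^ (j + 1)) * (∏ k ∈ range s, (X - C (a * q ^ k))).coeff (j + 1) =
      (q ^ (s + 1) - q ^ (j + 1)) * (∏ k ∈ range s, (X - C (a * q ^ k))).coeff j := by
  set G : ℂ[X] := ∏ k ∈ range s, (X - C (a * q ^ k)) with hG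
  have hcomp : ∀ m, (∏ k ∈ range m, (X - C (a * q ^ k))).comp (C q * X) =
      ∏ k ∈ range m, (C q * X - C (a * q ^ k)) := fun m => by
    rw [Polynomial.prod_comp]; simp
  -- Substituting `qX` shifts the geometric progression of roots by one place: both sides are the
  -- product of `qX - a q^k` over `k ≤ s`.
  have h : G.comp (C q * X) * (C q * X - C (a * q ^ s)) =
      (C q * X - C a) * (C (q ^ s) * G) := by
    rw [hG, hcomp, ← prod_range_succ (fun k => C q * X - C (a * q ^ k)), prod_range_succ']
    have : ∀ k, C q * X - C (a * q ^ (k + 1)) = C q * (X - C (a * q ^ k)) := fun k => by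
      rw [mul_sub, ← C_mul]; congr 2; ring
    simp_rw [this]
    rw [prod_mul_distrib, prod_const, card_range, C_pow, pow_zero, mul_one, mul_comm]
  have h' : C q * (X * G.comp (C q * X)) - C (a * q ^ s) * G.comp (C q * X) =
      C (q * q ^ s) * (X * G) - C (a * q ^ s) * G := by
    simp only [C_mul] at h ⊢
    linear_combination h
  have h1 := congrArg (fun f => coeff f (j + 1)) h'
  simp only [coeff_sub, coeff_C_mul, coeff_X_mul, comp_C_mul_X_coeff] at h1
  linear_combination h1

theorem bchGenerator_eq (n s : ℕ) : bchGenerator n s =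
    ∏ k ∈ range s, (X - C (omega n ^ ((n - s + 1) / 2) * omega n ^ k)) := by
  simp only [bchGenerator, pow_add]

theorem monic_bchGenerator (n s : ℕ) : (bchGenerator n s).Monic :=
  monic_prod_of_monic _ _ fun _ _ => monic_X_sub_C _

theorem natDegree_bchGenerator (n s : ℕ) : (bchGenerator n s).natDegree = s := by
  rw [bchGenerator, natDegree_prod_of_monic _ _ fun i _ => monic_X_sub_C _]
  simp only [natDegree_X_sub_C, sum_const, smul_eq_mul, mul_one, card_range]

theorem coeff_zero_bchGenerator_pow {n : ℕ} (hn : n ≠ 0) (s : ℕ) :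
    (bchGenerator n s).coeff 0 ^ (2 * n) = 1 := by
  rw [coeff_zero_eq_eval_zero, bchGenerator, eval_prod]
  simpa using prod_neg_omega_pow hn (range s) fun k => (n - s + 1) / 2 + k

theorem coeff_succ_bchGenerator {n s j : ℕ} (hs : s < n) (hj : j < s) :
    omega n ^ ((n - s + 1) / 2 + s) * (1 - omega n ^ (j + 1)) ≠ 0 ∧
    (bchGenerator n s).coeff (j + 1) =
      (omega n ^ (s + 1) - omega n ^ (j + 1)) * (bchGenerator n s).coeff j /
        (omega n ^ ((n - s + 1) / 2 + s) * (1 - omega n ^ (j + 1))) := by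
  have hn : n ≠ 0 := by omega
  have hne : omega n ^ ((n - s + 1) / 2 + s) * (1 - omega n ^ (j + 1)) ≠ 0 :=
    mul_ne_zero (pow_ne_zero _ (omega_ne_zero n)) (sub_ne_zero.2
      ((isPrimitiveRoot_omega hn).pow_ne_one_of_pos_of_lt (by omega) (by omega)).symm)
  refine ⟨hne, ?_⟩
  rw [eq_div_iff hne, bchGenerator_eq, ← coeff_prod_X_sub_C_geometric, pow_add]
  ring

/-- By the recurrence, consecutive coefficients differ by a factor that is nonzero for `j < s`, and
the constant term is a root of unity. -/
theorem coeff_bchGenerator_ne_zero_iff {n s : ℕ} (hs : s < n) (j : ℕ) :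
    (bchGenerator n s).coeff j ≠ 0 ↔ j ≤ s := by
  have hn : n ≠ 0 := by omega
  constructor
  · intro h
    by_contra! hj
    exact h (coeff_eq_zero_of_natDegree_lt (by rwa [natDegree_bchGenerator]))
  · intro hj
    induction j with
    | zero =>
      intro h
      have := coeff_zero_bchGenerator_pow hn s
      rw [h, zero_pow (by omega)] at this
      exact zero_ne_one this
    | succ j ih =>
      obtain ⟨h1, h2⟩ := coeff_succ_bchGenerator hs (j := j) (by omega)
      rw [h2]
      refine div_ne_zero (mul_ne_zero (fun h => ?_) (ih (by omega))) h1
      -- One factor `ω` is cancelled since `s + 1` may equal `n`, while `pow_inj` needs exponents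
      -- below `n`.
      rw [sub_eq_zero, pow_succ, pow_succ] at h
      have := (isPrimitiveRoot_omega hn).pow_inj hs (by omega)
        (mul_right_cancel₀ (omega_ne_zero n) h)
      omega

/-- Five operations per recurrence step. The case `s ≤ 1` must be free because `s log² s` vanishes
there; all coefficients are then 0, 1 or the constant term. -/
theorem cost_bchGenerator {n s : ℕ} (hs : s < n) :
    Cost freeConstants (Set.range (bchGenerator n s).coeff) (if s ≤ 1 then 0 else 5 * s) := by
  have hn : n ≠ 0 := by omega
  have h0 : (bchGenerator n s).coeff 0 ∈ freeConstants :=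
    mem_freeConstants_of_pow_eq_one (by omega) (coeff_zero_bchGenerator_pow hn s)
  have hbig : ∀ j, s < j → (bchGenerator n s).coeff j ∈ freeConstants := fun j hj => by
    rw [coeff_eq_zero_of_natDegree_lt (by rwa [natDegree_bchGenerator])]
    exact zero_mem_freeConstants
  split_ifs with h
  · refine Cost.of_subset ?_ _
    rintro _ ⟨j, rfl⟩
    obtain rfl | rfl | hj : j = 0 ∨ j = s ∨ s < j := by omega
    · exact h0
    · have := monic_bchGenerator n j
      rw [Monic, leadingCoeff, natDegree_bchGenerator] at this
      rw [this]
      exact one_mem_freeConstants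
    · exact hbig j hj
  · have h1 := Cost.sequence (a := 5) (bchGenerator n s).coeff s (Cost.mem h0) fun j hj => by
      obtain ⟨h1, h2⟩ := coeff_succ_bchGenerator hs hj
      have hfree : ∀ k, omega n ^ k ∈ freeConstants ∪ {(bchGenerator n s).coeff j} :=
        fun k => Or.inl (omega_pow_mem_freeConstants hn k)
      have e1 := (Cost.op (hfree (s + 1)) (hfree (j + 1)) (Or.inr (Or.inl rfl))).op₂
        (Cost.mem (Or.inr rfl)) (Or.inr (Or.inr (Or.inl rfl)))
      have e2 := (Cost.mem (hfree ((n - s + 1) / 2 + s))).op₂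
        (Cost.op (Or.inl one_mem_freeConstants) (hfree (j + 1)) (Or.inr (Or.inl rfl)))
        (Or.inr (Or.inr (Or.inl rfl)))
      exact e1.op₂ e2 (Or.inr (Or.inr (Or.inr ⟨h1, h2⟩)))
    refine (h1.union (Cost.of_subset (T := freeConstants) subset_rfl 0)).mono subset_rfl ?_
      (le_of_eq (by ring))
    rintro _ ⟨j, rfl⟩
    rcases Nat.lt_or_ge s j with hj | hj
    · exact Or.inr (hbig j hj)
    · exact Or.inl ⟨j, hj, rfl⟩

theorem conj_omega_pow {n e : ℕ} (he : e ≤ n) (hn : n ≠ 0) :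
    starRingEnd ℂ (omega n ^ e) = omega n ^ (n - e) := by
  have h1 : starRingEnd ℂ (omega n) = (omega n)⁻¹ := by
    rw [omega, ← Complex.exp_conj, ← Complex.exp_neg]
    congr 1
    simp [Complex.conj_ofReal, Complex.conj_ofNat, neg_div]
  rw [map_pow, h1, inv_pow]
  refine inv_eq_of_mul_eq_one_right ?_
  rw [← pow_add, show e + (n - e) = n by omega, (isPrimitiveRoot_omega hn).pow_eq_one]

/-- For `n - s` odd, the first and last exponents `b` and `b + s - 1` add up to `n`, so conjugation
`ω^e ↦ ω^{n-e}` reverses the list of roots. -/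
theorem conj_coeff_bchGenerator {n s : ℕ} (hs : s < n) (hodd : ¬ n ≡ s [MOD 2]) (j : ℕ) :
    starRingEnd ℂ ((bchGenerator n s).coeff j) = (bchGenerator n s).coeff j := by
  have hn : n ≠ 0 := by omega
  have h : (bchGenerator n s).map (starRingEnd ℂ) = bchGenerator n s := by
    rw [bchGenerator, Polynomial.map_prod, ← prod_range_reflect]
    refine prod_congr rfl fun k hk => ?_
    have hk' := mem_range.1 hk
    have hpar : (n - s) % 2 = 1 := by
      have : ¬ n % 2 = s % 2 := hodd
      omega
    rw [Polynomial.map_sub, map_X, map_C, conj_omega_pow (by omega) hn]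
    congr 4
    omega
  rw [← coeff_map, h]

theorem eval_bchGenerator_one_ne_zero {n s : ℕ} (hs : s < n) :
    (bchGenerator n s).eval 1 ≠ 0 := by
  rw [bchGenerator, eval_prod, prod_ne_zero_iff]
  intro k hk
  have hk' := mem_range.1 hk
  rw [eval_sub, eval_X, eval_C]
  exact sub_ne_zero.2 ((isPrimitiveRoot_omega (by omega)).pow_ne_one_of_pos_of_lt
    (by omega) (by omega)).symm

theorem eval_bchGenerator_eq_zero {n s e : ℕ} (h1 : (n - s + 1) / 2 ≤ e)
    (h2 : e < (n - s + 1) / 2 + s) : (bchGenerator n s).eval (omega n ^ e) = 0 := by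
  rw [bchGenerator, eval_prod]
  refine prod_eq_zero (mem_range.2 (by omega : e - (n - s + 1) / 2 < s)) ?_
  rw [Nat.add_sub_cancel' h1]
  simp

/-! ### The real scheme: the decoder -/

/-- A truncated power series inverse of a product of linear factors. -/
theorem exists_inverse_mod_X_pow {ι : Type*} {I : Set ℂ} (hI : freeConstants ⊆ I) (r : ι → ℂ)
    (hr : ∀ i, r i ∈ I) (hr0 : ∀ i, r i ≠ 0) {b : ℕ} (hb : 0 < b) (S : Finset ι) :
    ∃ h : ℂ[X], h.natDegree < b ∧ X ^ b ∣ (∏ i ∈ S, (X - C (r i))) * h - 1 ∧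
      Cost I (Set.range h.coeff) (2 * b * #S) := by
  classical
  induction S using Finset.induction_on with
  | empty =>
    refine ⟨1, by simpa using hb, by simp, Cost.of_subset ?_ _⟩
    rintro _ ⟨m, rfl⟩
    rw [coeff_one]
    split_ifs
    · exact hI one_mem_freeConstants
    · exact hI zero_mem_freeConstants
  | insert i S hi ih =>
    obtain ⟨h, hd, hdvd, hcost⟩ := ih
    -- Power series division of `h` by `X - r i`: comparing coefficients gives `q (m-1) - r i * q m
    -- = h_m`.
    let q : ℕ → ℂ := fun m =>
      Nat.rec ((0 - h.coeff 0) / r i) (fun m x => (x - h.coeff (m + 1)) / r i) m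
    have hq0 : q 0 = (0 - h.coeff 0) / r i := rfl
    have hq1 : ∀ m, q (m + 1) = (q m - h.coeff (m + 1)) / r i := fun m => rfl
    set h' : ℂ[X] := ∑ m ∈ range b, C (q m) * X ^ m with hh'
    have hc : ∀ m, h'.coeff m = if m < b then q m else 0 := by
      intro m
      simp only [hh', finsetSum_coeff, coeff_C_mul_X_pow, sum_ite_eq, mem_range]
    refine ⟨h', ?_, ?_, ?_⟩
    · have : h'.natDegree ≤ b - 1 := natDegree_le_iff_coeff_eq_zero.2 fun m hm => by
        rw [hc, if_neg (by omega)]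
      omega
    · have h1 : X ^ b ∣ (X - C (r i)) * h' - h := by
        rw [X_pow_dvd_iff]
        intro d hd
        rw [coeff_sub, sub_mul, coeff_sub, coeff_C_mul]
        rcases d with _ | d
        · rw [coeff_X_mul_zero, hc, if_pos hd, hq0]
          field_simp [hr0 i]
          ring
        · rw [coeff_X_mul, hc, hc, if_pos hd, if_pos (by omega), hq1]
          field_simp [hr0 i]
          ring
      rw [prod_insert hi]
      have h2 := dvd_add (h1.mul_left (∏ i ∈ S, (X - C (r i)))) hdvd
      convert h2 using 1
      ring
    · have e : Cost (I ∪ Set.range h.coeff) (q '' {k | k ≤ b - 1}) (2 + (b - 1) * 2) := by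
        refine Cost.sequence q (b - 1) ?_ fun k _ => ?_
        · exact (Cost.op (Or.inl (hI zero_mem_freeConstants)) (Or.inr ⟨0, rfl⟩)
            (Or.inr (Or.inl rfl))).op₂ (Cost.mem (Or.inl (hr i)))
            (Or.inr (Or.inr (Or.inr ⟨hr0 i, hq0⟩)))
        · exact (Cost.op (Or.inr rfl) (Or.inl (Or.inr ⟨k + 1, rfl⟩))
            (Or.inr (Or.inl rfl))).op₂ (Cost.mem (Or.inl (Or.inl (hr i))))
            (Or.inr (Or.inr (Or.inr ⟨hr0 i, hq1 k⟩)))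
      refine ((hcost.bind e).union (Cost.mem (hI zero_mem_freeConstants))).mono subset_rfl ?_ ?_
      · rintro _ ⟨m, rfl⟩
        rw [hc]
        split_ifs with hm
        · exact Or.inl ⟨m, by simp only [Set.mem_ofPred_eq]; omega, rfl⟩
        · exact Or.inr rfl
      · rw [card_insert_of_notMem hi]
        obtain ⟨b, rfl⟩ : ∃ c, b = c + 1 := ⟨b - 1, by omega⟩
        rw [Nat.add_sub_cancel]
        exact le_of_eq (by ring)

/-- Schoolbook multiplication by linear factors. -/
theorem cost_prod_X_sub_C_mul {ι : Type*} {I : Set ℂ} (hI : freeConstants ⊆ I) (r : ι → ℂ)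
    (hr : ∀ i, r i ∈ I) {f : ℂ[X]} (hf : Set.range f.coeff ⊆ I) {N : ℕ} (S : Finset ι)
    (hN : f.natDegree + #S < N) :
    Cost I (Set.range ((∏ i ∈ S, (X - C (r i))) * f).coeff) (2 * N * #S) := by
  classical
  induction S using Finset.induction_on with
  | empty => exact Cost.of_subset (by simpa using hf) _
  | insert i S hi ih =>
    rw [card_insert_of_notMem hi] at hN
    have h1 := ih (by omega)
    rw [prod_insert hi, mul_assoc, card_insert_of_notMem hi]
    set g := (∏ i ∈ S, (X - C (r i))) * f with hg
    have hgd : g.natDegree + 1 < N := by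
      have h2 : (∏ i ∈ S, (X - C (r i))).natDegree = #S := by
        rw [natDegree_prod_of_monic _ _ fun i _ => monic_X_sub_C _]
        simp only [natDegree_X_sub_C, sum_const, smul_eq_mul, mul_one]
      have := natDegree_mul_le (p := ∏ i ∈ S, (X - C (r i))) (q := f)
      rw [← hg] at this
      omega
    have h2 := (h1.bind (Cost.image (a := 2) (range N) ((X - C (r i)) * g).coeff fun m _ => by
      have hg' : Cost (I ∪ Set.range g.coeff) {(X * g).coeff m} 0 := by
        rcases m with _ | m
        · rw [coeff_X_mul_zero]; exact Cost.mem (Or.inl (hI zero_mem_freeConstants))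
        · rw [coeff_X_mul]; exact Cost.mem (Or.inr ⟨m, rfl⟩)
      exact hg'.op₂ (Cost.op (Or.inl (hr i)) (Or.inr ⟨m, rfl⟩) (Or.inr (Or.inr (Or.inl rfl))))
        (Or.inr (Or.inl (by rw [sub_mul, coeff_sub, coeff_C_mul]))))).union
      (Cost.mem (hI zero_mem_freeConstants))
    refine h2.mono subset_rfl ?_ (le_of_eq (by rw [card_range]; ring))
    rintro _ ⟨m, rfl⟩
    rcases Nat.lt_or_ge m N with hm | hm
    · exact Or.inl ⟨m, by simpa using hm, rfl⟩
    · refine Or.inr (coeff_eq_zero_of_natDegree_lt ?_)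
      have := natDegree_mul_le (p := X - C (r i)) (q := g)
      rw [natDegree_X_sub_C] at this
      omega

/-- Decoding coefficients from a polynomial `Y` with constant term `1` whose other exponents
belong to roots of the generator. -/
theorem sum_eval_mul_circulant_bch {n s : ℕ} (hs : s < n) {Y : ℂ[X]} (hY0 : Y.coeff 0 = 1)
    (hYd : Y.natDegree < (n - s + 1) / 2 + s)
    (hY : ∀ e, 0 < e → e < (n - s + 1) / 2 → Y.coeff e = 0) (j : Fin n) :
    ∑ i : Fin n, Y.eval (omega n ^ (i : ℕ)) *
      Matrix.circulant (fun i : Fin n => (bchGenerator n s).coeff i) i j =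
        (bchGenerator n s).eval 1 := by
  rw [sum_mul_circulant (fun i : Fin n => Y.eval (omega n ^ (i : ℕ)))]
  have h1 : ∀ i : Fin n, Y.eval (omega n ^ ((i + j : Fin n) : ℕ)) * (bchGenerator n s).coeff i =
      ∑ e ∈ range ((n - s + 1) / 2 + s), Y.coeff e * (omega n ^ (j : ℕ)) ^ e *
        ((bchGenerator n s).coeff i * (omega n ^ e) ^ (i : ℕ)) := by
    intro i
    rw [omega_pow_fin_add, eval_eq_sum_range' hYd, sum_mul]
    refine sum_congr rfl fun e _ => ?_
    rw [mul_pow, ← pow_mul, ← pow_mul, ← pow_mul, mul_comm e (i : ℕ)]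
    ring
  have h2 : ∀ x : ℂ, ∑ i : Fin n, (bchGenerator n s).coeff i * x ^ (i : ℕ) =
      (bchGenerator n s).eval x := by
    intro x
    rw [Fin.sum_univ_eq_sum_range (fun i => (bchGenerator n s).coeff i * x ^ i),
      ← eval_eq_sum_range' (by rwa [natDegree_bchGenerator])]
  simp_rw [h1]
  rw [sum_comm]
  simp_rw [← mul_sum, h2]
  rw [sum_eq_single 0]
  · simp [hY0]
  · intro e he he0
    rcases Nat.lt_or_ge e ((n - s + 1) / 2) with h | h
    · rw [hY e (by omega) h]; ring
    · rw [eval_bchGenerator_eq_zero h (mem_range.1 he)]; ring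
  · intro h; exact absurd (mem_range.2 (by omega)) h

/-- The values of the decoding polynomial outside of `S`. -/
theorem cost_decodingPoly {n s : ℕ} (hs0 : 0 < s) (hs : s < n) {S : Finset (Fin n)} (hS : #S = s)
    {h : ℂ[X]} (hd : h.natDegree < (n - s + 1) / 2)
    (hcost : Cost freeConstants (Set.range h.coeff) (2 * ((n - s + 1) / 2) * s))
    (hY : ∀ e, 0 < e → e < (n - s + 1) / 2 → (locator S * h).coeff e = 0) :
    Cost freeConstants ((fun i : Fin n => (locator S * h).eval (omega n ^ (i : ℕ))) '' (Sᶜ :))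
      (9 * (s * (n - s))) := by
  have hn : n ≠ 0 := by omega
  set b := (n - s + 1) / 2 with hb
  have hb1 : b ≤ n - s := by omega
  have hcard : #Sᶜ = n - s := by rw [card_compl, Fintype.card_fin, hS]
  have hpow : ∀ i e : ℕ, (omega n ^ i) ^ e ∈ freeConstants := fun i e => by
    rw [← pow_mul]; exact omega_pow_mem_freeConstants hn _
  have hbs : b * s ≤ s * (n - s) := by rw [mul_comm]; exact Nat.mul_le_mul_left _ hb1
  -- If `s < n - s`, expanding `Λ h` costs `O(s(n-s))`, and at most `s + 1` coefficients matter at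
  -- each of `n - s` points. Otherwise `b ≤ n - s ≤ s`, and evaluating the two factors separately
  -- costs `O(s)` per point.
  rcases Nat.lt_or_ge s (n - s) with hlt | hge
  · have h1 := hcost.bind (cost_prod_X_sub_C_mul (I := freeConstants ∪ Set.range h.coeff)
      Set.subset_union_left (fun k : Fin n => omega n ^ (k : ℕ))
      (fun k => Or.inl (omega_pow_mem_freeConstants hn _)) (fun x hx => Or.inr hx) S
      (N := b + s) (by omega))
    change Cost freeConstants (Set.range (locator S * h).coeff) _ at h1
    have hYd : (locator S * h).natDegree < b + s := by
      have := natDegree_mul_le (p := locator S) (q := h)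
      rw [natDegree_locator, hS] at this
      omega
    have h2 := h1.bind (Cost.image (a := 3 * s) Sᶜ
      (fun i : Fin n => (locator S * h).eval (omega n ^ (i : ℕ))) fun i _ => by
        have e1 := Cost.sum (I := freeConstants ∪ Set.range (locator S * h).coeff)
          (Or.inl zero_mem_freeConstants) (Ico b (b + s))
          (fun e => (locator S * h).coeff e * (omega n ^ (i : ℕ)) ^ e) (a := 1) fun e _ =>
            Cost.op (Or.inr ⟨e, rfl⟩) (Or.inl (hpow i e)) (Or.inr (Or.inr (Or.inl rfl)))
        have e2 := (Cost.mem (I := freeConstants ∪ Set.range (locator S * h).coeff)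
          (Or.inr ⟨0, rfl⟩)).op₂ e1 (z := (locator S * h).eval (omega n ^ (i : ℕ))) (Or.inl (by
            rw [eval_eq_sum_range' hYd, ← sum_range_add_sum_Ico _ (Nat.le_add_right b s)]
            congr 1
            rw [sum_eq_single 0]
            · simp
            · intro e he he0
              rw [hY e (by omega) (mem_range.1 he), zero_mul]
            · intro h; exact absurd (mem_range.2 (by omega)) h))
        refine e2.mono subset_rfl subset_rfl ?_
        rw [Nat.card_Ico]
        omega)
    refine h2.mono subset_rfl subset_rfl ?_
    rw [hcard, hS]
    have hss : s * s ≤ s * (n - s) := Nat.mul_le_mul_left _ hlt.le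
    calc 2 * b * s + 2 * (b + s) * s + (n - s) * (3 * s)
        = 4 * (b * s) + 2 * (s * s) + 3 * (s * (n - s)) := by ring
      _ ≤ _ := by omega
  · have h1 := hcost.bind (Cost.image (a := 2 * s + 2 * b + 1) Sᶜ
      (fun i : Fin n => (locator S * h).eval (omega n ^ (i : ℕ))) fun i _ => by
        have e1 := Cost.sum (I := freeConstants ∪ Set.range h.coeff)
          (Or.inl zero_mem_freeConstants) (range b)
          (fun e => h.coeff e * (omega n ^ (i : ℕ)) ^ e) (a := 1) fun e _ =>
            Cost.op (Or.inr ⟨e, rfl⟩) (Or.inl (hpow i e)) (Or.inr (Or.inr (Or.inl rfl)))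
        have e2 := Cost.prod (I := freeConstants ∪ Set.range h.coeff)
          (Or.inl one_mem_freeConstants) S
          (fun k => omega n ^ (i : ℕ) - omega n ^ (k : ℕ)) (a := 1) fun k _ =>
            Cost.op (Or.inl (omega_pow_mem_freeConstants hn _))
              (Or.inl (omega_pow_mem_freeConstants hn _)) (Or.inr (Or.inl rfl))
        refine (e2.op₂ e1 (Or.inr (Or.inr (Or.inl ?_)))).mono subset_rfl subset_rfl ?_
        · rw [eval_mul, eval_eq_sum_range' hd, locator, eval_prod]
          simp only [eval_sub, eval_X, eval_C]
        · rw [card_range, hS]; omega)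
    refine h1.mono subset_rfl subset_rfl ?_
    rw [hcard]
    calc 2 * b * s + (n - s) * (2 * s + 2 * b + 1)
        ≤ 2 * (b * s) + (n - s) * (5 * s) := by
          rw [mul_assoc]
          exact Nat.add_le_add_left (Nat.mul_le_mul_left _ (by omega)) _
      _ = 2 * (b * s) + 5 * (s * (n - s)) := by ring
      _ ≤ _ := by omega

theorem exists_bchDecoder {n s : ℕ} (hs0 : 0 < s) (hs : s < n) {S : Finset (Fin n)}
    (hS : #S = s) : ∃ y : Fin n → ℂ, (∀ i ∈ S, y i = 0) ∧
      (∀ j, ∑ i, y i * Matrix.circulant (fun i : Fin n => (bchGenerator n s).coeff i) i j = 1) ∧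
      Cost freeConstants (Set.range y) (12 * (s * (n - s))) := by
  have hn : n ≠ 0 := by omega
  obtain ⟨h, hd, hdvd, hcost⟩ := exists_inverse_mod_X_pow subset_rfl
    (fun k : Fin n => omega n ^ (k : ℕ)) (fun k => omega_pow_mem_freeConstants hn _)
    (fun k => pow_ne_zero _ (omega_ne_zero n)) (b := (n - s + 1) / 2) (by omega) S
  change X ^ _ ∣ locator S * h - 1 at hdvd
  rw [X_pow_dvd_iff] at hdvd
  rw [hS] at hcost
  have hg := eval_bchGenerator_one_ne_zero hs
  have hY0 : (locator S * h).coeff 0 = 1 := by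
    have := hdvd 0 (by omega)
    rwa [coeff_sub, coeff_one_zero, sub_eq_zero] at this
  have hY : ∀ e, 0 < e → e < (n - s + 1) / 2 → (locator S * h).coeff e = 0 := by
    intro e he he'
    have := hdvd e he'
    rwa [coeff_sub, coeff_one, if_neg (by omega), sub_zero] at this
  have hYd : (locator S * h).natDegree < (n - s + 1) / 2 + s := by
    have := natDegree_mul_le (p := locator S) (q := h)
    rw [natDegree_locator, hS] at this
    omega
  have hzero : ∀ i ∈ S, (locator S * h).eval (omega n ^ (i : ℕ)) /
      (bchGenerator n s).eval 1 = 0 := fun i hi => by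
    rw [eval_mul, eval_locator_eq_zero hi, zero_mul, zero_div]
  refine ⟨fun i => (locator S * h).eval (omega n ^ (i : ℕ)) / (bchGenerator n s).eval 1,
    hzero, fun j => ?_, ?_⟩
  · simp_rw [div_mul_eq_mul_div]
    rw [← sum_div, sum_eval_mul_circulant_bch hs hY0 hYd hY j, div_self hg]
  · have h1 := Cost.prod one_mem_freeConstants (range s)
      (fun k => 1 - omega n ^ ((n - s + 1) / 2 + k)) (a := 1) fun k _ =>
        Cost.op one_mem_freeConstants (omega_pow_mem_freeConstants hn _) (Or.inr (Or.inl rfl))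
    have hg1 : ∏ k ∈ range s, (1 - omega n ^ ((n - s + 1) / 2 + k)) =
        (bchGenerator n s).eval 1 := by
      rw [bchGenerator, eval_prod]
      simp only [eval_sub, eval_X, eval_C]
    rw [hg1] at h1
    have h2 := ((cost_decodingPoly hs0 hs hS hd hcost hY).union h1).bind
      (Cost.image (a := 1) Sᶜ (fun i : Fin n => (locator S * h).eval (omega n ^ (i : ℕ)) /
        (bchGenerator n s).eval 1) fun i hi =>
        Cost.op (Or.inr (Or.inl ⟨i, hi, rfl⟩)) (Or.inr (Or.inr rfl))
          (Or.inr (Or.inr (Or.inr ⟨hg, rfl⟩))))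
    refine (h2.union (Cost.mem zero_mem_freeConstants)).mono subset_rfl ?_ ?_
    · rintro _ ⟨i, rfl⟩
      by_cases hi : i ∈ S
      · exact Or.inr (hzero i hi)
      · exact Or.inl ⟨i, by simpa using hi, rfl⟩
    · rw [card_range, card_compl, Fintype.card_fin, hS]
      have e1 : s ≤ s * (n - s) := Nat.le_mul_of_pos_right _ (by omega)
      have e2 : n - s ≤ s * (n - s) := Nat.le_mul_of_pos_left _ hs0
      omega

/-- Real decoding vectors for every set of at least `n - s` workers. -/
theorem exists_realDecodingVector {n s : ℕ} (hs : s < n) (hodd : ¬ n ≡ s [MOD 2])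
    (K : Finset (Fin n)) (hK : n - s ≤ #K) : ∃ a : Fin n → ℝ, Function.support a ⊆ K ∧
      Matrix.vecMul a (Matrix.circulant fun i : Fin n => ((bchGenerator n s).coeff i).re) = 1 ∧
      Cost freeConstants (Set.range fun i => (a i : ℂ)) (26 * (s * (n - s))) := by
  have hn : n ≠ 0 := by omega
  rcases Nat.eq_zero_or_pos s with rfl | hs0
  -- For `s = 0` the generator is 1, the matrix is the identity, and the all-ones vector decodes at
  -- no cost.
  · have hKu : K = univ := (card_eq_iff_eq_univ K).1
      (le_antisymm (card_le_univ K) (by simpa using hK))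
    refine ⟨1, by simp [hKu], ?_, Cost.of_subset ?_ _⟩
    · have : NeZero n := ⟨hn⟩
      have h1 : (fun i : Fin n => ((bchGenerator n 0).coeff i).re) = Pi.single 0 1 := by
        ext i
        rw [bchGenerator, range_zero, prod_empty, coeff_one, Pi.single_apply]
        by_cases h : i = 0
        · simp [h]
        · rw [if_neg h, if_neg fun h' => h (Fin.ext (by simpa using h')), Complex.zero_re]
      rw [h1, Matrix.circulant_single_one, Matrix.vecMul_one]
    · rintro _ ⟨i, rfl⟩
      simpa using one_mem_freeConstants
  · have hKn : #K ≤ n := by simpa using card_le_univ K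
    -- Declaring further workers stragglers reduces to exactly `s` of them.
    obtain ⟨S, hKS, -, hS⟩ := exists_subsuperset_card_eq (n := s) (subset_univ Kᶜ)
      (by rw [card_compl, Fintype.card_fin]; omega) (by rw [card_univ, Fintype.card_fin]; omega)
    obtain ⟨y, hy0, hy, hcost⟩ := exists_bchDecoder hs0 hs hS
    refine ⟨fun i => (y i).re, fun i hi => ?_, ?_, ?_⟩
    · by_contra h
      exact hi (by simp [hy0 i (hKS (by simpa using h))])
    · ext j
      have h1 := congrArg Complex.re (hy j)
      rw [Complex.re_sum, Complex.one_re] at h1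
      rw [Matrix.vecMul, dotProduct, Pi.one_apply, ← h1]
      refine sum_congr rfl fun i _ => ?_
      rw [Matrix.circulant_apply, Matrix.circulant_apply,
        ← Complex.conj_eq_iff_re.1 (conj_coeff_bchGenerator hs hodd _), Complex.re_mul_ofReal,
        Complex.ofReal_re]
    -- `Re y = (y + conj y) / 2`; the free constants are closed under conjugation, so the conjugates
    -- cost as much as `y`.
    · have h1 := (hcost.union hcost.conj_free).bind
        (Cost.image (a := 2) Sᶜ (fun i => ((y i).re : ℂ)) fun i _ =>
          (Cost.op (Or.inr (Or.inl ⟨i, rfl⟩)) (Or.inr (Or.inr ⟨y i, ⟨i, rfl⟩, rfl⟩))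
            (Or.inl rfl)).op₂ (Cost.mem (x := (2 : ℂ))
              (Or.inl (by simpa using natCast_mem_freeConstants 2)))
            (Or.inr (Or.inr (Or.inr ⟨two_ne_zero, Complex.re_eq_add_conj _⟩))))
      refine (h1.union (Cost.mem zero_mem_freeConstants)).mono subset_rfl ?_ ?_
      · rintro _ ⟨i, rfl⟩
        by_cases hi : i ∈ S
        · exact Or.inr (by simp [hy0 i hi])
        · exact Or.inl ⟨i, by simpa using hi, rfl⟩
      · rw [card_compl, Fintype.card_fin, hS]
        have e2 : n - s ≤ s * (n - s) := Nat.le_mul_of_pos_left _ hs0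
        omega

theorem bchEncoder_bound {n s : ℕ} (hs : s < n) :
    ((if s ≤ 1 then 0 else 5 * s : ℕ) : ℝ) ≤
      20 * min ((s : ℝ) * Real.log s ^ 2) ((n : ℝ) * Real.log n) := by
  have hn : 0 ≤ Real.log n := Real.log_natCast_nonneg n
  split_ifs with h
  · rw [Nat.cast_zero]
    positivity
  · have hlog2 : (0.69 : ℝ) < Real.log 2 := lt_trans (by norm_num) Real.log_two_gt_d9
    have h2 : (2 : ℝ) ≤ s := by exact_mod_cast (by omega : 2 ≤ s)
    have hsn : (s : ℝ) ≤ n := by exact_mod_cast hs.le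
    have h3 : (0.69 : ℝ) ≤ Real.log s := hlog2.le.trans (Real.log_le_log (by norm_num) h2)
    have h4 : Real.log s ≤ Real.log n := Real.log_le_log (by linarith) hsn
    push_cast
    have h5 : (s : ℝ) * 0.25 ≤ min ((s : ℝ) * Real.log s ^ 2) ((n : ℝ) * Real.log n) := by
      refine le_min (mul_le_mul_of_nonneg_left (by nlinarith) (by linarith)) ?_
      exact mul_le_mul hsn (by linarith) (by norm_num) (by linarith)
    linarith

end GradientCoding

/-! ### Assembly of both schemes -/

open GradientCoding in
theorem mainTheorem4 :
    ∃ C : ℝ, 0 < C ∧ ∀ n s : ℕ, s < n →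
      (∃ (A : Finset (Fin n) → Fin n → ℂ) (B : Matrix (Fin n) (Fin n) ℂ),
        B = cyclicShiftMatrix (complexCodeword n s) ∧
        OptimalExactScheme s A B ∧
        ComputableWithin freeConstants (entries B) (C * ((s : ℝ) * ((n : ℝ) - s))) ∧
        ∀ K : Finset (Fin n), n - s ≤ K.card →
          ComputableWithin freeConstants (Set.range (A K))
            (C * ((s : ℝ) * Real.log s ^ 2 + (n : ℝ) * Real.log n))) ∧
      (¬ n ≡ s [MOD 2] →
        ∃ (A : Finset (Fin n) → Fin n → ℝ) (B : Matrix (Fin n) (Fin n) ℝ),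
          B.map (fun x : ℝ => (x : ℂ)) =
            cyclicShiftMatrix (fun i : Fin n => (bchGenerator n s).coeff i) ∧
          OptimalExactScheme s A B ∧
          ComputableWithin freeConstants (entries (B.map (fun x : ℝ => (x : ℂ))))
            (C * min ((s : ℝ) * Real.log s ^ 2) ((n : ℝ) * Real.log n)) ∧
          ∀ K : Finset (Fin n), n - s ≤ K.card →
            ComputableWithin freeConstants (Set.range fun i => ((A K i : ℝ) : ℂ))
              (C * ((vandermondeInversionCost s : ℝ) + (s : ℝ) * ((n : ℝ) - s)))) := by
  obtain ⟨C₀, hC₀, hdec⟩ := exists_complexDecoder_bound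
  -- 26 is the real decoding constant and dominates the encoding constants 4 and 20.
  refine ⟨C₀ + 26, by linarith, fun n s hs => ?_⟩
  have hsub : ((n - s : ℕ) : ℝ) = (n : ℝ) - s := Nat.cast_sub hs.le
  have hprod : 0 ≤ (s : ℝ) * ((n : ℝ) - s) := by rw [← hsub]; positivity
  have hlog : 0 ≤ Real.log n := Real.log_natCast_nonneg n
  refine ⟨⟨complexDecoder n s, _, rfl, optimalExactScheme_circulant hs _
    complexCodeword_ne_zero_iff (exactComputation_complex hs),
    (cost_complexEncoder hs).computableWithin ?_, fun K hK => ?_⟩, fun hodd => ?_⟩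
  · push_cast [hsub]
    nlinarith
  · obtain ⟨L, hL, h⟩ := hdec n s hs K hK
    exact ⟨L, hL.trans (mul_le_mul_of_nonneg_right (by linarith) (by positivity)), h⟩
  · classical
    let c : Fin n → ℝ := fun i => ((bchGenerator n s).coeff i).re
    have hc : ∀ i, ((c i : ℝ) : ℂ) = (bchGenerator n s).coeff i := fun i =>
      Complex.conj_eq_iff_re.1 (conj_coeff_bchGenerator hs hodd i)
    have hmap : (Matrix.circulant c).map (fun x : ℝ => (x : ℂ)) =
        cyclicShiftMatrix (fun i : Fin n => (bchGenerator n s).coeff i) := by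
      ext i j
      rw [Matrix.map_apply, cyclicShiftMatrix, Matrix.circulant_apply, Matrix.circulant_apply, hc]
    choose a ha1 ha2 ha3 using exists_realDecodingVector hs hodd
    let A : Finset (Fin n) → Fin n → ℝ := fun K => if h : n - s ≤ K.card then a K h else 0
    have hA : ∀ K (h : n - s ≤ K.card), A K = a K h := fun K h => dif_pos h
    refine ⟨A, Matrix.circulant c, hmap, optimalExactScheme_circulant hs c (fun i => ?_)
      ⟨fun K _ => ?_, fun K hK => ?_⟩, ?_, fun K hK => ?_⟩
    · rw [← coeff_bchGenerator_ne_zero_iff hs, ← hc, Complex.ofReal_ne_zero]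
    · by_cases h : n - s ≤ K.card
      · rw [hA K h]; exact ha1 K h
      · rw [show A K = 0 from dif_neg h]; simp
    · rw [hA K hK]; exact ha2 K hK
    · rw [hmap]
      refine ((cost_bchGenerator hs).mono subset_rfl ?_ le_rfl).computableWithin
        ((bchEncoder_bound hs).trans
          (mul_le_mul_of_nonneg_right (by linarith) (by positivity)))
      rintro _ ⟨i, j, rfl⟩
      exact ⟨_, rfl⟩
    · rw [hA K hK]
      refine (ha3 K hK).computableWithin ?_
      push_cast [hsub]
      -- The decoder meets the bound through `s(n-s)` alone, so `g_s` enters only as a nonnegative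
      -- summand.
      have hg : (0 : ℝ) ≤ vandermondeInversionCost s := Nat.cast_nonneg _
      nlinarith
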